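/- **Setting.** Use independent variables $x$, $\tau_0=t$, $\tau_1,\tau_2,\dots$ and jet variables $u_{x^j}$, $j\ge 0$ (with $u_{x^0}=u$). A *differential function* on an open set $D$ of the space of all these variables (with the product topology) is a real function on $D$ that is a smooth function of finitely many of them. Let $F_i$, $i\ge 0$, be differential functions on $D$, and put $$D_x=\frac{\partial}{\partial x}+\sum_{j\ge 0}u_{x^{j+1}}\frac{\partial}{\partial u_{x^j}},\qquad D_{\tau_i}=\frac{\partial}{\partial\tau_i}+\sum_{j\ge 0}(D_x^jF_i)\frac{\partial}{\partial u_{x^j}} .$$ The evolution equations $u_{\tau_i}=F_i$, $i\ge 0$, form a *hierarchy of pseudo-spherical type* with associated one-forms $$\Theta^{[n]}_\alpha=f_{\alpha1}\,dx+f_{\alpha2}\,dt+\sum_{i=1}^n h_{\alpha i}\,d\tau_i,\qquad \alpha=1,2,3,\ n\ge 0,$$ where $f_{\alpha1},f_{\alpha2},h_{\alpha i}$ are differential functions on $D$, if for every $n\ge 0$ $$d_H\Theta^{[n]}_1=\Theta^{[n]}_3\wedge\Theta^{[n]}_2,\qquad d_H\Theta^{[n]}_2=\Theta^{[n]}_1\wedge\Theta^{[n]}_3,\qquad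 d_H\Theta^{[n]}_3=\Theta^{[n]}_1\wedge\Theta^{[n]}_2$$ on $D$, with $d_Hg=D_xg\,dx+\sum_{i=0}^nD_{\tau_i}g\,d\tau_i$ and $d_H(dx)=d_H(d\tau_i)=0$. Regard $\mathbb R^{n+2}$, with coordinates $(x,t,\tau_1,\dots,\tau_n)$, as the hyperplane $\tau_{n+1}=0$ of $\mathbb R^{n+3}$. A *local solution* of the hierarchy is a sequence of smooth functions $u^{[n]}:W^{[n]}\to\mathbb R$ on non-empty open sets $W^{[n]}\subset\mathbb R^{n+2}$, $n\ge 0$, with $W^{[n]}\subset W^{[n+1]}$ and $u^{[n+1]}|_{W^{[n]}}=u^{[n]}$, such that the jets of $u^{[n]}$ lie in $D$ and $u^{[n]}$ satisfies $u_{\tau_i}=F_i$ for $i=0,\dots,n$. (When a differential function is evaluated on $u^{[n]}$, any variable $\tau_k$ with $k>n$ is set to $0$.) The pull-back of $\Theta^{[n]}_\alpha$ by $u^{[n]}$, obtained by evaluating its coefficients on $u^{[n]}$, is a one-form on $W^{[n]}$, again denoted by $\Theta^{[n]}_\alpha$. The function $u^{[0]}(x,t)$ is *III-generic* if the pulled-back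 two-form $\Theta^{[0]}_1\wedge\Theta^{[0]}_2$ vanishes nowhere on $W^{[0]}$. **Theorem.** Let $u_{\tau_i}=F_i$ and $\widehat u_{\widehat\tau_i}=\widehat F_i$, $i\ge 0$, be two hierarchies of pseudo-spherical type with associated one-forms $\Theta^{[n]}_\alpha$ and $\widehat\Theta^{[n]}_\alpha$. Let $\{u^{[n]}\}$ and $\{\widehat u^{[n]}\}$ be local solutions of them such that $u^{[0]}$ and $\widehat u^{[0]}$ are III-generic. Then for each $n\ge 0$ there exist non-empty open subsets $V^{[n]}$ and $\widehat V^{[n]}$ of the domains of $u^{[n]}$ and $\widehat u^{[n]}$ respectively, a local diffeomorphism $\Upsilon^{[n]}:V^{[n]}\to\widehat V^{[n]}$ (that is, a smooth bijection of $V^{[n]}$ onto $\widehat V^{[n]}$ with smooth inverse), and a smooth function $\mu^{[n]}:V^{[n]}\to\mathbb R$, such that the pulled-back forms satisfy, on $V^{[n]}$, $$\Upsilon^{[n]*}\widehat\Theta^{[n]}_1=\Theta^{[n]}_1\cos\mu^{[n]}+\Theta^{[n]}_2\sin\mu^{[n]},$$ $$\Upsilon^{[n]*}\widehat\Theta^{[n]}_2=-\Theta^{[n]}_1\sin\mu^{[n]}+\Theta^{[n]}_2\cos\mu^{[n]},$$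 $$\Upsilon^{[n]*}\widehat\Theta^{[n]}_3=\Theta^{[n]}_3+d\mu^{[n]}.$$ Moreover, these can be chosen so that, for all $n\ge 0$, $V^{[n]}\subset V^{[n+1]}$ and $$\Upsilon^{[n+1]}|_{V^{[n]}}=\Upsilon^{[n]},\qquad \mu^{[n+1]}|_{V^{[n]}}=\mu^{[n]}.$$ -/

import Mathlib

open scoped ContDiff

namespace PSHierarchy

noncomputable section

/-- The infinite jet space. A point `(y, w)` consists of the independent variables
`y 0 = x`, `y (i + 1) = τ_i` (so that `y 1 = τ_0 = t`), and of the jet variables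
`w j = u_{x^j}` (so that `w 0 = u`). It carries the product topology. -/
abbrev Jet : Type := (ℕ → ℝ) × (ℕ → ℝ)

/-- The first `N` independent variables and the first `N` jet variables. -/
def truncate (N : ℕ) (q : Jet) : (Fin N → ℝ) × (Fin N → ℝ) :=
  (fun a => q.1 a, fun j => q.2 j)

/-- `g` is a differential function on the open set `D` of the jet space: a smooth function of
finitely many of the variables `x, t, τ_1, τ_2, …, u, u_x, u_xx, …`. -/
def IsDiffFun (D : Set Jet) (g : Jet → ℝ) : Prop :=
  ∃ (N : ℕ) (G : (Fin N → ℝ) × (Fin N → ℝ) → ℝ),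
    ContDiffOn ℝ ∞ G (truncate N '' D) ∧ ∀ q ∈ D, g q = G (truncate N q)

/-- The partial derivative with respect to the `a`-th independent variable. -/
def pdBase (a : ℕ) (g : Jet → ℝ) (q : Jet) : ℝ :=
  deriv (fun s : ℝ => g (Function.update q.1 a s, q.2)) (q.1 a)

/-- The partial derivative with respect to `u_{x^j}`. -/
def pdJet (j : ℕ) (g : Jet → ℝ) (q : Jet) : ℝ :=
  deriv (fun s : ℝ => g (q.1, Function.update q.2 j s)) (q.2 j)

/-- The total derivative `D_x = ∂/∂x + ∑_j u_{x^{j+1}} ∂/∂u_{x^j}`. On a differential function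
only finitely many terms of the sum are nonzero. -/
def totalX (g : Jet → ℝ) (q : Jet) : ℝ :=
  pdBase 0 g q + ∑ᶠ j : ℕ, q.2 (j + 1) * pdJet j g q

/-- The evolutionary total derivative `D_{τ_i} = ∂/∂τ_i + ∑_j (D_x^j F_i) ∂/∂u_{x^j}`. -/
def totalTau (F : ℕ → Jet → ℝ) (i : ℕ) (g : Jet → ℝ) (q : Jet) : ℝ :=
  pdBase (i + 1) g q + ∑ᶠ j : ℕ, (totalX^[j] (F i)) q * pdJet j g q

/-- The total derivative in the direction of the `a`-th independent variable:
`D_x` for `a = 0` and `D_{τ_i}` for `a = i + 1`. -/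
def totalD (F : ℕ → Jet → ℝ) : ℕ → (Jet → ℝ) → Jet → ℝ
  | 0 => totalX
  | i + 1 => totalTau F i

/-- The coefficient at `dy_a ∧ dy_b` (`a < b`) of the horizontal differential
`d_H (∑_b g_b dy_b) = ∑_{a, b} (D_a g_b) dy_a ∧ dy_b`. -/
def dH (F : ℕ → Jet → ℝ) {m : ℕ} (g : Fin m → Jet → ℝ) (a b : Fin m) (q : Jet) : ℝ :=
  totalD F a (g b) q - totalD F b (g a) q

/-- The coefficients of the wedge product of two covectors `∑ φ_a dy_a` and `∑ ψ_a dy_a`. -/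
def wedge {m : ℕ} (φ ψ : Fin m → ℝ) (a b : Fin m) : ℝ :=
  φ a * ψ b - φ b * ψ a

/-- The coefficients of `Θ^{[n]}_{α+1}`, in the order `dx, dt, dτ_1, …, dτ_n`. -/
def Theta (θ : Fin 3 → ℕ → Jet → ℝ) (n : ℕ) (α : Fin 3) (a : Fin (n + 2)) : Jet → ℝ :=
  θ α a

/-- The equations `u_{τ_i} = F_i` form a hierarchy of pseudo-spherical type, on the open
domain `D` of the jet space, with associated one-forms
`Θ^{[n]}_α = f_{α1} dx + f_{α2} dt + ∑_{i=1}^n h_{αi} dτ_i`.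
The coefficients are `θ (α-1) 0 = f_{α1}`, `θ (α-1) 1 = f_{α2}`, `θ (α-1) (i+1) = h_{αi}`. -/
structure IsHierarchy (D : Set Jet) (F : ℕ → Jet → ℝ) (θ : Fin 3 → ℕ → Jet → ℝ) : Prop where
  isOpen_domain : IsOpen D
  diffFun_rhs : ∀ i, IsDiffFun D (F i)
  diffFun_coeff : ∀ α a, IsDiffFun D (θ α a)
  structure_one : ∀ n, ∀ q ∈ D, ∀ a b : Fin (n + 2),
    dH F (Theta θ n 0) a b q =
      wedge (fun c => Theta θ n 2 c q) (fun c => Theta θ n 1 c q) a b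
  structure_two : ∀ n, ∀ q ∈ D, ∀ a b : Fin (n + 2),
    dH F (Theta θ n 1) a b q =
      wedge (fun c => Theta θ n 0 c q) (fun c => Theta θ n 2 c q) a b
  structure_three : ∀ n, ∀ q ∈ D, ∀ a b : Fin (n + 2),
    dH F (Theta θ n 2) a b q =
      wedge (fun c => Theta θ n 0 c q) (fun c => Theta θ n 1 c q) a b

/-- The space `ℝ^{n+2}` of the independent variables `(x, t, τ_1, …, τ_n)`. -/
abbrev Base (n : ℕ) : Type := Fin (n + 2) → ℝ

/-- The inclusion of `ℝ^{n+2}` into `ℝ^{n+3}` as the hyperplane `τ_{n+1} = 0`. -/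
def incl {n : ℕ} (p : Base n) : Base (n + 1) :=
  Fin.snoc (α := fun _ => ℝ) p 0

/-- The partial derivative of a function on `ℝ^{n+2}` in the `a`-th coordinate direction. -/
def pd {n : ℕ} (a : Fin (n + 2)) (v : Base n → ℝ) (p : Base n) : ℝ :=
  fderiv ℝ v p (Pi.single a 1)

/-- The jet of `v` at `p`: the independent variables (with `τ_k = 0` for `k > n`), and the
`x`-derivatives of `v` of all orders. -/
def jet {n : ℕ} (v : Base n → ℝ) (p : Base n) : Jet :=
  (fun a => if h : a < n + 2 then p ⟨a, h⟩ else 0, fun j => ((pd 0)^[j] v) p)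

/-- A local solution `u^{[n]} : dom n → ℝ`, `n ≥ 0`, of the hierarchy `u_{τ_i} = F_i`. -/
structure IsSolution (D : Set Jet) (F : ℕ → Jet → ℝ)
    (dom : (n : ℕ) → Set (Base n)) (u : (n : ℕ) → Base n → ℝ) : Prop where
  isOpen_dom : ∀ n, IsOpen (dom n)
  nonempty_dom : ∀ n, (dom n).Nonempty
  smooth : ∀ n, ContDiffOn ℝ ∞ (u n) (dom n)
  jet_mem : ∀ n, ∀ p ∈ dom n, jet (u n) p ∈ D
  solves : ∀ n, ∀ p ∈ dom n, ∀ i : Fin (n + 1), pd i.succ (u n) p = F i (jet (u n) p)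
  dom_incl : ∀ n, ∀ p ∈ dom n, incl p ∈ dom (n + 1)
  restrict : ∀ n, ∀ p ∈ dom n, u (n + 1) (incl p) = u n p

/-- The coefficients at `p` of the pull-back of `Θ^{[n]}_{α+1}` by the function `v`. -/
def coeffAt (θ : Fin 3 → ℕ → Jet → ℝ) {n : ℕ} (v : Base n → ℝ) (α : Fin 3) (p : Base n) :
    Fin (n + 2) → ℝ :=
  fun a => Theta θ n α a (jet v p)

/-- The pull-back of `Θ^{[n]}_{α+1}` by the function `v`, a one-form on `ℝ^{n+2}`. -/
def pullForm (θ : Fin 3 → ℕ → Jet → ℝ) {n : ℕ} (v : Base n → ℝ) (α : Fin 3) (p : Base n) :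
    Base n →L[ℝ] ℝ :=
  ∑ a : Fin (n + 2), coeffAt θ v α p a • ContinuousLinearMap.proj (R := ℝ) (φ := fun _ => ℝ) a

/-- A function `v (x, t)` on `U` is `III`-generic: `Θ^{[0]}_1 ∧ Θ^{[0]}_2`, pulled back by `v`,
vanishes nowhere on `U`. -/
def IsIIIGeneric (θ : Fin 3 → ℕ → Jet → ℝ) (U : Set (Base 0)) (v : Base 0 → ℝ) : Prop :=
  ∀ p ∈ U, wedge (coeffAt θ v 0 p) (coeffAt θ v 1 p) ≠ 0

end

end PSHierarchy

namespace PSHierarchy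

open Set Filter Topology Metric

/-! ### Differential functions -/

/-! On a solution, total derivatives become partial derivatives (`pd_comp_jet_of_solution`), so the
pulled-back forms w₁, w₂, w₃ satisfy the structure equations of curvature −1 in all n + 2 variables.
Every such triple has the same normal form. By the structure equations, dμ = cos μ w₁ + sin μ w₂ −
w₃ is completely integrable. For a solution μ put η = cos μ w₁ + sin μ w₂ and ξ = −sin μ w₁ + cos μ
w₂. Then η = w₃ + dμ, dξ = 0 and dη = η ∧ ξ, whence ξ = db and η = exp(−b) da. Two solutions are
compared by passing through this common form: with e = (a, b, τ₁, …, τ_n) and e', m' for the second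
hierarchy, Υ = e'⁻¹ ∘ e and the angle is m − m' ∘ Υ. III-genericity makes (a, b) a local
diffeomorphism of the (x, t)-plane at a base point c.

The delicate point is coherence in n: the domains have to be nested, although the room in the
τ-directions may shrink as n grows. First, μ, b, a are determined by their vanishing at c
(`IsNormalForm.eqOn`), so those of level n + 1 restrict to those of level n. Second, the equations
have bounded right-hand sides, so they are solved on a whole star-shaped set
(`exists_total_differential`). Third, e is injective on a set cut out by conditions on whole (x,
t)-slices over one disc, fixed at level 0; these conditions pass from n to n + 1
(`exists_straightening`), whereas a separate inverse function theorem for each n would give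
unrelated neighbourhoods. -/

theorem isOpenMap_truncate (N : ℕ) : IsOpenMap (truncate N) := by
  refine IsOpenMap.of_sections fun q => ⟨fun r =>
    (fun a => if h : a < N then r.1 ⟨a, h⟩ else q.1 a,
      fun j => if h : j < N then r.2 ⟨j, h⟩ else q.2 j), ?_, ?_, ?_⟩
  · refine Continuous.continuousAt (Continuous.prodMk ?_ ?_) <;> refine continuous_pi fun a => ?_
    · by_cases h : a < N
      · simp only [h, dif_pos]; fun_prop
      · simp only [h, dif_neg, not_false_eq_true]; fun_prop
    · by_cases h : a < N
      · simp only [h, dif_pos]; fun_prop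
      · simp only [h, dif_neg, not_false_eq_true]; fun_prop
  · ext a <;> simp [truncate]
  · intro r
    ext a <;> simp [truncate]

/-- `G`, a smooth function of the first `N` variables, represents `g` on `D`. -/
structure Represents (D : Set Jet) (g : Jet → ℝ) (N : ℕ)
    (G : (Fin N → ℝ) × (Fin N → ℝ) → ℝ) : Prop where
  smooth : ContDiffOn ℝ ∞ G (truncate N '' D)
  eq : ∀ q ∈ D, g q = G (truncate N q)

theorem Represents.hasFDerivAt {D : Set Jet} (hD : IsOpen D) {g : Jet → ℝ} {N : ℕ}
    {G : (Fin N → ℝ) × (Fin N → ℝ) → ℝ} (hG : Represents D g N G)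
    {X : Type*} [NormedAddCommGroup X] [NormedSpace ℝ X] {J : X → Jet} {x : X}
    (hJ : ∀ᶠ z in 𝓝 x, J z ∈ D) {L : X →L[ℝ] (Fin N → ℝ) × (Fin N → ℝ)}
    (hL : HasFDerivAt (fun z => truncate N (J z)) L x) :
    HasFDerivAt (fun z => g (J z)) ((fderiv ℝ G (truncate N (J x))).comp L) x := by
  have hx : J x ∈ D := hJ.self_of_nhds
  have hopen : IsOpen (truncate N '' D) := isOpenMap_truncate N D hD
  have h1 : DifferentiableAt ℝ G (truncate N (J x)) :=
    (hG.smooth.contDiffAt (hopen.mem_nhds ⟨_, hx, rfl⟩)).differentiableAt (by simp)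
  refine (h1.hasFDerivAt.comp x hL).congr_of_eventuallyEq ?_
  filter_upwards [hJ] with z hz
  exact hG.eq _ hz

theorem Represents.pdBase_eq {D : Set Jet} (hD : IsOpen D) {g : Jet → ℝ} {N : ℕ}
    {G : (Fin N → ℝ) × (Fin N → ℝ) → ℝ} (hG : Represents D g N G) {q : Jet} (hq : q ∈ D) (a : ℕ) :
    pdBase a g q = fderiv ℝ G (truncate N q) (truncate N (Pi.single a 1, 0)) := by
  have hJ : ∀ᶠ s : ℝ in 𝓝 (q.1 a), (Function.update q.1 a s, q.2) ∈ D := by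
    refine (Continuous.continuousAt (by fun_prop)).preimage_mem_nhds (hD.mem_nhds ?_)
    simpa using hq
  have hL : HasDerivAt (fun s : ℝ => truncate N (Function.update q.1 a s, q.2))
      (truncate N (Pi.single a 1, 0)) (q.1 a) := by
    refine HasDerivAt.prodMk ?_ (hasDerivAt_pi.2 fun b => hasDerivAt_const _ _)
    refine hasDerivAt_pi.2 fun b => ?_
    exact hasDerivAt_pi.1 (hasDerivAt_update q.1 a (q.1 a)) b
  have := (hG.hasFDerivAt hD hJ hL.hasFDerivAt).hasDerivAt.deriv
  simpa [pdBase] using this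

theorem Represents.pdJet_eq {D : Set Jet} (hD : IsOpen D) {g : Jet → ℝ} {N : ℕ}
    {G : (Fin N → ℝ) × (Fin N → ℝ) → ℝ} (hG : Represents D g N G) {q : Jet} (hq : q ∈ D) (j : ℕ) :
    pdJet j g q = fderiv ℝ G (truncate N q) (truncate N (0, Pi.single j 1)) := by
  have hJ : ∀ᶠ s : ℝ in 𝓝 (q.2 j), (q.1, Function.update q.2 j s) ∈ D := by
    refine (Continuous.continuousAt (by fun_prop)).preimage_mem_nhds (hD.mem_nhds ?_)
    simpa using hq
  have hL : HasDerivAt (fun s : ℝ => truncate N (q.1, Function.update q.2 j s))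
      (truncate N (0, Pi.single j 1)) (q.2 j) := by
    refine HasDerivAt.prodMk (hasDerivAt_pi.2 fun b => hasDerivAt_const _ _) ?_
    refine hasDerivAt_pi.2 fun b => ?_
    exact hasDerivAt_pi.1 (hasDerivAt_update q.2 j (q.2 j)) b
  have := (hG.hasFDerivAt hD hJ hL.hasFDerivAt).hasDerivAt.deriv
  simpa [pdJet] using this

/-- `G` does not see u_{x^j} for j ≥ N, so the sum is finite, and by linearity it collapses to one
directional derivative of `G`. Taking `c` to be the jet shifted by one gives D_x; taking the
derivatives of the jet variables along a solution gives the chain rule. -/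
theorem Represents.total_eq {D : Set Jet} (hD : IsOpen D) {g : Jet → ℝ} {N : ℕ}
    {G : (Fin N → ℝ) × (Fin N → ℝ) → ℝ} (hG : Represents D g N G) {q : Jet} (hq : q ∈ D)
    (a : ℕ) (c : ℕ → ℝ) :
    pdBase a g q + ∑ᶠ j : ℕ, c j * pdJet j g q =
      fderiv ℝ G (truncate N q) (truncate N (Pi.single a 1, c)) := by
  have hsupp : (Function.support fun j => c j * pdJet j g q) ⊆ (Finset.range N : Set ℕ) := by
    intro j hj
    by_contra hjN
    refine hj ?_
    have : truncate N (0, Pi.single j 1) = 0 := by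
      refine Prod.ext rfl (funext fun b => ?_)
      have hb : (b : ℕ) ≠ j := by
        have := b.2
        simp only [Finset.coe_range, mem_Iio] at hjN
        omega
      simp [truncate, hb]
    simp [hG.pdJet_eq hD hq, this]
  have hdec : truncate N (Pi.single a 1, c) = truncate N (Pi.single a 1, 0) +
      ∑ j ∈ Finset.range N, c j • truncate N (0, Pi.single j 1) := by
    refine Prod.ext (funext fun b => ?_) (funext fun b => ?_)
    · simp [truncate, Prod.fst_sum]
    · simp [truncate, Prod.snd_sum, Pi.single_apply]
  rw [finsum_eq_sum_of_support_subset _ hsupp, hdec, map_add, map_sum, hG.pdBase_eq hD hq]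
  simp [hG.pdJet_eq hD hq]

theorem isDiffFun_totalX {D : Set Jet} (hD : IsOpen D) {g : Jet → ℝ} (hg : IsDiffFun D g) :
    IsDiffFun D (totalX g) := by
  obtain ⟨N, G, hGs, hGe⟩ := hg
  have hG : Represents D g N G := ⟨hGs, hGe⟩
  -- One more variable is needed: the last jet variable of `G`, with index N − 1, is differentiated
  -- with coefficient u_{x^N}.
  refine ⟨N + 1, fun r => fderiv ℝ G (fun a => r.1 a.castSucc, fun j => r.2 j.castSucc)
    (fun a => Pi.single (M := fun _ => ℝ) (0 : ℕ) 1 (a : ℕ), fun j => r.2 j.succ), ?_, ?_⟩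
  · have hopen : IsOpen (truncate N '' D) := isOpenMap_truncate N D hD
    refine ContDiffOn.clm_apply ?_ ?_
    · refine (hGs.fderiv_of_isOpen hopen (m := ∞) (by simp)).comp (t := truncate N '' D) ?_ ?_
      · exact ContDiff.contDiffOn (by fun_prop)
      · rintro _ ⟨q, hq, rfl⟩
        exact ⟨q, hq, rfl⟩
    · exact ContDiff.contDiffOn (by fun_prop)
  · intro q hq
    exact hG.total_eq hD hq 0 fun j => q.2 (j + 1)

theorem isDiffFun_iterate_totalX {D : Set Jet} (hD : IsOpen D) {g : Jet → ℝ} (hg : IsDiffFun D g)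
    (j : ℕ) : IsDiffFun D (totalX^[j] g) := by
  induction j with
  | zero => exact hg
  | succ j ih =>
    rw [Function.iterate_succ_apply']
    exact isDiffFun_totalX hD ih

/-! ### Evaluation on functions -/

theorem contDiffOn_pd {n : ℕ} {W : Set (Base n)} (hW : IsOpen W) {v : Base n → ℝ}
    (hv : ContDiffOn ℝ ∞ v W) (a : Fin (n + 2)) : ContDiffOn ℝ ∞ (pd a v) W :=
  (hv.fderiv_of_isOpen hW (m := ∞) (by simp)).clm_apply contDiffOn_const

theorem contDiffOn_iterate_pd {n : ℕ} {W : Set (Base n)} (hW : IsOpen W) {v : Base n → ℝ}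
    (hv : ContDiffOn ℝ ∞ v W) (j : ℕ) : ContDiffOn ℝ ∞ ((pd 0)^[j] v) W := by
  induction j with
  | zero => exact hv
  | succ j ih =>
    rw [Function.iterate_succ_apply']
    exact contDiffOn_pd hW ih 0

theorem pd_congr {n : ℕ} {W : Set (Base n)} (hW : IsOpen W) {v w : Base n → ℝ}
    (h : EqOn v w W) (a : Fin (n + 2)) : EqOn (pd a v) (pd a w) W := by
  intro p hp
  have : v =ᶠ[𝓝 p] w := h.eventuallyEq_of_mem (hW.mem_nhds hp)
  simp only [pd, this.fderiv_eq]

theorem iterate_pd_congr {n : ℕ} {W : Set (Base n)} (hW : IsOpen W) {v w : Base n → ℝ}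
    (h : EqOn v w W) (a : Fin (n + 2)) (j : ℕ) : EqOn ((pd a)^[j] v) ((pd a)^[j] w) W := by
  induction j with
  | zero => exact h
  | succ j ih =>
    simp only [Function.iterate_succ_apply']
    exact pd_congr hW ih a

theorem pd_comm {n : ℕ} {W : Set (Base n)} (hW : IsOpen W) {v : Base n → ℝ}
    (hv : ContDiffOn ℝ ∞ v W) (a b : Fin (n + 2)) : EqOn (pd a (pd b v)) (pd b (pd a v)) W := by
  intro p hp
  have hp' : ContDiffAt ℝ ∞ v p := hv.contDiffAt (hW.mem_nhds hp)
  have hd : DifferentiableAt ℝ (fderiv ℝ v) p :=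
    (hp'.fderiv_right (m := ∞) (by simp)).differentiableAt (by simp)
  have key : ∀ a b : Fin (n + 2), pd a (pd b v) p =
      fderiv ℝ (fderiv ℝ v) p (Pi.single a 1) (Pi.single b 1) := by
    intro a b
    have := (hd.hasFDerivAt.clm_apply (hasFDerivAt_const (Pi.single b (1 : ℝ)) p)).fderiv
    change fderiv ℝ (fun y => fderiv ℝ v y (Pi.single b 1)) p (Pi.single a 1) = _
    rw [this]
    simp
  rw [key, key]
  exact (hp'.isSymmSndFDerivAt (by simpa using ENat.LEInfty.out)).eq _ _

theorem pd_iterate_comm {n : ℕ} {W : Set (Base n)} (hW : IsOpen W) {v : Base n → ℝ}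
    (hv : ContDiffOn ℝ ∞ v W) (a : Fin (n + 2)) (j : ℕ) :
    EqOn (pd a ((pd 0)^[j] v)) ((pd 0)^[j] (pd a v)) W := by
  induction j with
  | zero => exact fun p _ => rfl
  | succ j ih =>
    simp only [Function.iterate_succ_apply']
    exact (pd_comm hW (contDiffOn_iterate_pd hW hv j) a 0).trans (pd_congr hW ih 0)

theorem hasFDerivAt_truncate_jet {n : ℕ} {W : Set (Base n)} (hW : IsOpen W) {v : Base n → ℝ}
    (hv : ContDiffOn ℝ ∞ v W) {p : Base n} (hp : p ∈ W) (N : ℕ) :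
    ∃ L : Base n →L[ℝ] (Fin N → ℝ) × (Fin N → ℝ),
      HasFDerivAt (fun z => truncate N (jet v z)) L p ∧
      ∀ a : Fin (n + 2), L (Pi.single a 1) =
        truncate N (Pi.single (a : ℕ) 1, fun j => pd a ((pd 0)^[j] v) p) := by
  refine ⟨ContinuousLinearMap.prod
    (ContinuousLinearMap.pi fun b : Fin N => if h : (b : ℕ) < n + 2 then
      ContinuousLinearMap.proj (R := ℝ) (φ := fun _ => ℝ) (⟨b, h⟩ : Fin (n + 2)) else 0)
    (ContinuousLinearMap.pi fun j : Fin N => fderiv ℝ ((pd 0)^[j] v) p), ?_, ?_⟩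
  · refine HasFDerivAt.prodMk (hasFDerivAt_pi.2 fun b => ?_) (hasFDerivAt_pi.2 fun j => ?_)
    · by_cases h : (b : ℕ) < n + 2
      · simp only [jet, h, dif_pos]
        exact hasFDerivAt_apply _ _
      · simp only [jet, h, dif_neg, not_false_eq_true]
        exact hasFDerivAt_const _ _
    · exact (((contDiffOn_iterate_pd hW hv j).contDiffAt (hW.mem_nhds hp)).differentiableAt
        (by simp)).hasFDerivAt
  · intro a
    refine Prod.ext (funext fun b => ?_) rfl
    by_cases h : (b : ℕ) < n + 2
    · simp [truncate, h, Pi.single_apply, Fin.ext_iff]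
    · have : (b : ℕ) ≠ a := by have := a.2; omega
      simp [truncate, h, Pi.single_apply, this]

theorem contDiffOn_comp_jet {D : Set Jet} {g : Jet → ℝ} (hg : IsDiffFun D g)
    {n : ℕ} {W : Set (Base n)} (hW : IsOpen W) {v : Base n → ℝ} (hv : ContDiffOn ℝ ∞ v W)
    (hjet : ∀ p ∈ W, jet v p ∈ D) : ContDiffOn ℝ ∞ (fun p => g (jet v p)) W := by
  obtain ⟨N, G, hGs, hGe⟩ := hg
  have hJ : ContDiffOn ℝ ∞ (fun p => truncate N (jet v p)) W := by
    refine ContDiffOn.prodMk (contDiffOn_pi.2 fun b => ?_)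
      (contDiffOn_pi.2 fun j => contDiffOn_iterate_pd hW hv j)
    by_cases h : (b : ℕ) < n + 2
    · simp only [jet, h, dif_pos]
      exact ContDiff.contDiffOn (by fun_prop)
    · simp only [jet, h, dif_neg, not_false_eq_true]
      exact contDiffOn_const
  exact (hGs.comp hJ fun p hp => ⟨_, hjet p hp, rfl⟩).congr fun p hp => hGe _ (hjet p hp)

theorem pd_comp_jet {D : Set Jet} (hD : IsOpen D) {g : Jet → ℝ} (hg : IsDiffFun D g)
    {n : ℕ} {W : Set (Base n)} (hW : IsOpen W) {v : Base n → ℝ} (hv : ContDiffOn ℝ ∞ v W)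
    (hjet : ∀ p ∈ W, jet v p ∈ D) {p : Base n} (hp : p ∈ W) (a : Fin (n + 2)) :
    pd a (fun z => g (jet v z)) p = pdBase a g (jet v p) +
      ∑ᶠ j : ℕ, pd a ((pd 0)^[j] v) p * pdJet j g (jet v p) := by
  obtain ⟨N, G, hGs, hGe⟩ := hg
  have hG : Represents D g N G := ⟨hGs, hGe⟩
  obtain ⟨L, hL, hLa⟩ := hasFDerivAt_truncate_jet hW hv hp N
  have hJ : ∀ᶠ z in 𝓝 p, jet v z ∈ D := by
    filter_upwards [hW.mem_nhds hp] with z hz using hjet z hz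
  rw [pd, (hG.hasFDerivAt hD hJ hL).fderiv, hG.total_eq hD (hjet p hp)]
  simp [hLa]

theorem pd_zero_comp_jet {D : Set Jet} (hD : IsOpen D) {g : Jet → ℝ} (hg : IsDiffFun D g)
    {n : ℕ} {W : Set (Base n)} (hW : IsOpen W) {v : Base n → ℝ} (hv : ContDiffOn ℝ ∞ v W)
    (hjet : ∀ p ∈ W, jet v p ∈ D) {p : Base n} (hp : p ∈ W) :
    pd 0 (fun z => g (jet v z)) p = totalX g (jet v p) := by
  rw [pd_comp_jet hD hg hW hv hjet hp]
  simp [totalX, jet, Function.iterate_succ_apply']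

theorem iterate_pd_zero_comp_jet {D : Set Jet} (hD : IsOpen D) {g : Jet → ℝ} (hg : IsDiffFun D g)
    {n : ℕ} {W : Set (Base n)} (hW : IsOpen W) {v : Base n → ℝ} (hv : ContDiffOn ℝ ∞ v W)
    (hjet : ∀ p ∈ W, jet v p ∈ D) (j : ℕ) :
    EqOn ((pd 0)^[j] fun z => g (jet v z)) (fun z => totalX^[j] g (jet v z)) W := by
  induction j with
  | zero => exact fun p _ => rfl
  | succ j ih =>
    simp only [Function.iterate_succ_apply']
    exact (pd_congr hW ih 0).trans fun p hp =>
      pd_zero_comp_jet hD (isDiffFun_iterate_totalX hD hg j) hW hv hjet hp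

/-- On solutions, total derivatives of differential functions are partial derivatives. -/
theorem pd_comp_jet_of_solution {D : Set Jet} (hD : IsOpen D) {F : ℕ → Jet → ℝ}
    (hF : ∀ i, IsDiffFun D (F i)) {g : Jet → ℝ} (hg : IsDiffFun D g)
    {n : ℕ} {W : Set (Base n)} (hW : IsOpen W) {v : Base n → ℝ} (hv : ContDiffOn ℝ ∞ v W)
    (hjet : ∀ p ∈ W, jet v p ∈ D)
    (hsol : ∀ p ∈ W, ∀ i : Fin (n + 1), pd i.succ v p = F i (jet v p))
    {p : Base n} (hp : p ∈ W) (a : Fin (n + 2)) :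
    pd a (fun z => g (jet v z)) p = totalD F a g (jet v p) := by
  refine Fin.cases ?_ (fun i => ?_) a
  · exact pd_zero_comp_jet hD hg hW hv hjet hp
  -- Mixed partials commute, so ∂_{τ_i} u_{x^j} = ∂_x^j u_{τ_i} = ∂_x^j (F_i on the solution) =
  -- D_x^j F_i.
  · have key : ∀ j, pd i.succ ((pd 0)^[j] v) p = totalX^[j] (F i) (jet v p) := by
      intro j
      rw [pd_iterate_comm hW hv i.succ j hp]
      exact (iterate_pd_congr hW (fun z hz => hsol z hz i) 0 j).trans
        (iterate_pd_zero_comp_jet hD (hF i) hW hv hjet j) hp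
    rw [pd_comp_jet hD hg hW hv hjet hp]
    simp [totalD, totalTau, key]

/-! ### Total differential equations -/

theorem gronwallBound_zero_eq_mul (K ε x : ℝ) :
    gronwallBound 0 K ε x = ε * gronwallBound 0 K 1 x := by
  by_cases hK : K = 0
  · simp [gronwallBound, hK]
  · simp [gronwallBound, hK]; ring

/-- Grönwall with zero initial value. The bound is linear in ε, so an inhomogeneity that is O or o
of the displacement of the parameter gives an error of the same order. -/
theorem abs_le_gronwallBound_of_unit_interval {f f' : ℝ → ℝ} {K ε : ℝ} (hK : 0 ≤ K) (hε : 0 ≤ ε)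
    (h0 : f 0 = 0) (hf : ∀ s ∈ Icc (0 : ℝ) 1, HasDerivWithinAt f (f' s) (Icc 0 1) s)
    (hb : ∀ s ∈ Icc (0 : ℝ) 1, |f' s| ≤ K * |f s| + ε) :
    ∀ s ∈ Icc (0 : ℝ) 1, |f s| ≤ ε * gronwallBound 0 K 1 1 := by
  intro s hs
  have h1 := norm_le_gronwallBound_of_norm_deriv_right_le (f := f) (f' := f') (δ := 0) (K := K)
    (ε := ε) (a := 0) (b := 1) (fun s hs => (hf s hs).continuousWithinAt)
    (fun s hs => (hf s (Ico_subset_Icc_self hs)).mono_of_mem_nhdsWithin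
      (Icc_mem_nhdsGE_of_mem hs)) (by simp [h0])
    (fun s hs => hb s (Ico_subset_Icc_self hs)) s hs
  rw [Real.norm_eq_abs] at h1
  rw [← gronwallBound_zero_eq_mul]
  exact h1.trans (gronwallBound_mono le_rfl hε hK (by linarith [hs.2]))

/-- The derivative is bounded and uniformly continuous on a compact set, and convexity lets the mean
value inequality be applied on segments. -/
theorem exists_uniform_differentiability {X : Type*} [NormedAddCommGroup X] [NormedSpace ℝ X]
    {f : X → ℝ} {K : Set X} (hK : IsCompact K) (hconv : Convex ℝ K)
    (hf : ∀ x ∈ K, ContDiffAt ℝ 1 f x) :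
    ∃ C : ℝ, 0 ≤ C ∧ (∀ x ∈ K, ‖fderiv ℝ f x‖ ≤ C) ∧
      (∀ x ∈ K, ∀ y ∈ K, |f y - f x| ≤ C * ‖y - x‖) ∧
      ∀ ε > 0, ∃ δ > 0, ∀ x ∈ K, ∀ y ∈ K, ‖y - x‖ < δ →
        |f y - f x - fderiv ℝ f x (y - x)| ≤ ε * ‖y - x‖ := by
  have hdiff : ∀ x ∈ K, DifferentiableAt ℝ f x := fun x hx => (hf x hx).differentiableAt (by simp)
  have hcont : ContinuousOn (fderiv ℝ f) K := fun x hx =>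
    ((hf x hx).fderiv_right (m := 0) (by simp)).continuousAt.continuousWithinAt
  obtain ⟨C, hC⟩ := hK.exists_bound_of_continuousOn hcont
  refine ⟨max C 0, le_max_right _ _, fun x hx => (hC x hx).trans (le_max_left _ _), ?_, ?_⟩
  · intro x hx y hy
    exact hconv.norm_image_sub_le_of_norm_fderiv_le hdiff
      (fun z hz => (hC z hz).trans (le_max_left _ _)) hx hy
  · intro ε hε
    obtain ⟨δ, hδ, h⟩ := Metric.uniformContinuousOn_iff.1
      (hK.uniformContinuousOn_of_continuous hcont) ε hε
    refine ⟨δ, hδ, fun x hx y hy hxy => ?_⟩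
    have hseg : segment ℝ x y ⊆ K := hconv.segment_subset hx hy
    refine (convex_segment x y).norm_image_sub_le_of_norm_hasFDerivWithin_le'
      (f' := fderiv ℝ f) (fun z hz => (hdiff z (hseg hz)).hasFDerivAt.hasFDerivWithinAt)
      (fun z hz => ?_) (left_mem_segment ℝ x y) (right_mem_segment ℝ x y)
    rw [← dist_eq_norm]
    refine (h z (hseg hz) x hx ?_).le
    rw [dist_eq_norm]
    exact (norm_sub_le_of_mem_segment hz).trans_lt hxy

/-- Differentiable dependence of solutions of an ordinary differential equation on a parameter. -/
theorem hasFDerivAt_endpoint {E : Type*} [NormedAddCommGroup E] [NormedSpace ℝ E]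
    [FiniteDimensional ℝ E] {Ψ : ℝ × E × ℝ → ℝ} {Y : E → ℝ → ℝ} {p : E} {δ B : ℝ} (hδ : 0 < δ)
    (hΨ : ∀ x ∈ Icc (0 : ℝ) 1 ×ˢ closedBall p δ ×ˢ Icc (-B) B, ContDiffAt ℝ 1 Ψ x)
    (hYB : ∀ q ∈ closedBall p δ, ∀ s ∈ Icc (0 : ℝ) 1, Y q s ∈ Icc (-B) B)
    (hY0 : ∀ q ∈ closedBall p δ, Y q 0 = 0)
    (hY : ∀ q ∈ closedBall p δ, ∀ s ∈ Icc (0 : ℝ) 1,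
      HasDerivWithinAt (Y q) (Ψ (s, q, Y q s)) (Icc 0 1) s)
    {Z : ℝ → E →L[ℝ] ℝ} (hZ0 : Z 0 = 0)
    (hZ : ∀ h, ∀ s ∈ Icc (0 : ℝ) 1, HasDerivWithinAt (fun s => Z s h)
      (fderiv ℝ Ψ (s, p, Y p s) (0, h, Z s h)) (Icc 0 1) s) :
    HasFDerivAt (fun q => Y q 1) (Z 1) p := by
  have : ProperSpace E := FiniteDimensional.proper ℝ E
  obtain ⟨C, hC0, hC1, hC2, hC3⟩ := exists_uniform_differentiability
    (isCompact_Icc.prod ((isCompact_closedBall p δ).prod isCompact_Icc))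
    ((convex_Icc (0 : ℝ) 1).prod ((convex_closedBall p δ).prod (convex_Icc (-B) B))) hΨ
  set A := gronwallBound 0 C 1 1 with hA
  have hA0 : 0 ≤ A := by
    have := gronwallBound_mono (δ := 0) (K := C) (ε := 1) le_rfl zero_le_one hC0
      (zero_le_one (α := ℝ))
    rwa [gronwallBound_x0] at this
  have hp : p ∈ closedBall p δ := mem_closedBall_self hδ.le
  have hnorm : ∀ (q : E) (s y y' : ℝ), ‖(s, q, y) - (s, p, y')‖ ≤ ‖q - p‖ + |y - y'| := by
    intro q s y y'
    simp only [Prod.mk_sub_mk, sub_self, Prod.norm_mk, norm_zero]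
    refine max_le (by positivity) (max_le ?_ ?_)
    · linarith [abs_nonneg (y - y')]
    · rw [Real.norm_eq_abs]; linarith [norm_nonneg (q - p)]
  have hlip : ∀ q ∈ closedBall p δ, ∀ s ∈ Icc (0 : ℝ) 1,
      |Y q s - Y p s| ≤ C * ‖q - p‖ * A := by
    intro q hq
    refine abs_le_gronwallBound_of_unit_interval (f := fun s => Y q s - Y p s) hC0 (by positivity)
      (by simp [hY0 q hq, hY0 p hp]) (fun s hs => (hY q hq s hs).sub (hY p hp s hs)) ?_
    intro s hs
    refine (hC2 _ ⟨hs, hp, hYB p hp s hs⟩ _ ⟨hs, hq, hYB q hq s hs⟩).trans ?_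
    have := mul_le_mul_of_nonneg_left (hnorm q s (Y q s) (Y p s)) hC0
    linarith
  rw [hasFDerivAt_iff_isLittleO, Asymptotics.isLittleO_iff]
  intro ε hε
  -- By `hlip`, the points (s, q, Y q s) and (s, p, Y p s) are at distance at most M ‖q − p‖.
  set M := 1 + C * A with hM
  have hM1 : 1 ≤ M := by rw [hM]; nlinarith [mul_nonneg hC0 hA0]
  -- Grönwall multiplies the Taylor remainder by A, and the distance contributes M; dividing ε by M
  -- A + 1 absorbs both factors and avoids division by zero.
  obtain ⟨δ', hδ', hrem⟩ := hC3 (ε / (M * A + 1)) (by positivity)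
  have hnhds : ball p (min δ (δ' / M)) ∈ 𝓝 p := ball_mem_nhds _ (by positivity)
  filter_upwards [hnhds] with q hq
  have hq1 : q ∈ closedBall p δ := ball_subset_closedBall (ball_subset_ball (min_le_left _ _) hq)
  have hq2 : ‖q - p‖ < δ' / M := by
    rw [← dist_eq_norm]; exact (mem_ball.1 hq).trans_le (min_le_right _ _)
  have hfin := abs_le_gronwallBound_of_unit_interval
    (f := fun s => Y q s - Y p s - Z s (q - p)) (K := C)
    (ε := ε / (M * A + 1) * (M * ‖q - p‖)) hC0 (by positivity)
    (by simp [hY0 q hq1, hY0 p hp, hZ0])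
    (fun s hs => ((hY q hq1 s hs).sub (hY p hp s hs)).sub (hZ (q - p) s hs)) ?_ 1 (by simp)
  · refine hfin.trans ?_
    rw [← hA]
    have : M * A / (M * A + 1) ≤ 1 := by
      rw [div_le_one (by positivity)]; linarith
    calc ε / (M * A + 1) * (M * ‖q - p‖) * A = ε * ‖q - p‖ * (M * A / (M * A + 1)) := by ring
      _ ≤ ε * ‖q - p‖ * 1 := by gcongr
      _ = ε * ‖q - p‖ := mul_one _
  · intro s hs
    have hx : (s, p, Y p s) ∈ Icc (0 : ℝ) 1 ×ˢ closedBall p δ ×ˢ Icc (-B) B :=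
      ⟨hs, hp, hYB p hp s hs⟩
    have hy : (s, q, Y q s) ∈ Icc (0 : ℝ) 1 ×ˢ closedBall p δ ×ˢ Icc (-B) B :=
      ⟨hs, hq1, hYB q hq1 s hs⟩
    have hdist : ‖(s, q, Y q s) - (s, p, Y p s)‖ ≤ M * ‖q - p‖ := by
      refine (hnorm _ _ _ _).trans ?_
      have := hlip q hq1 s hs
      rw [hM]; linarith
    have hr := hrem _ hx _ hy (hdist.trans_lt (by
      rw [mul_comm]; exact (lt_div_iff₀ (by positivity)).1 hq2))
    have hr' := hr.trans (mul_le_mul_of_nonneg_left hdist (by positivity))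
    -- The increment is the linearized displacement plus the error being estimated. The derivative
    -- of Ψ sends the latter to at most C times its size, which is the Grönwall inequality for the
    -- error.
    have hsplit : ((s, q, Y q s) - (s, p, Y p s) : ℝ × E × ℝ) =
        (0, q - p, Z s (q - p)) + (0, 0, Y q s - Y p s - Z s (q - p)) := by
      simp
    have hw : |fderiv ℝ Ψ (s, p, Y p s) (0, 0, Y q s - Y p s - Z s (q - p))| ≤
        C * |Y q s - Y p s - Z s (q - p)| := by
      refine ((fderiv ℝ Ψ (s, p, Y p s)).le_opNorm _).trans ?_
      have : ‖((0 : ℝ), (0 : E), Y q s - Y p s - Z s (q - p))‖ =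
        |Y q s - Y p s - Z s (q - p)| := by simp [Prod.norm_mk]
      rw [this]
      exact mul_le_mul_of_nonneg_right (hC1 _ hx) (abs_nonneg _)
    rw [hsplit, map_add] at hr'
    refine le_trans ?_ (add_le_add hw hr')
    refine le_trans (le_of_eq ?_) (abs_add_le _ _)
    congr 1
    ring

/-! ### Frobenius' theorem for one scalar unknown. -/

/-- `Ω` is star-shaped about `c`. -/
def IsStar {E : Type*} [NormedAddCommGroup E] [NormedSpace ℝ E] (c : E) (Ω : Set E) : Prop :=
  ∀ p ∈ Ω, ∀ s ∈ Icc (0 : ℝ) 1, c + s • (p - c) ∈ Ω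

/-- An integrable total differential equation `dy = Φ (p, y)` on an open set `Ω`, with
right-hand side of locally bounded growth and Lipschitz constant. -/
structure IsIntegrable {E : Type*} [NormedAddCommGroup E] [NormedSpace ℝ E]
    (Ω : Set E) (Φ : E × ℝ → E →L[ℝ] ℝ) (M : E → ℝ) : Prop where
  smooth : ContDiffOn ℝ ∞ Φ (Ω ×ˢ univ)
  continuousOn_bound : ContinuousOn M Ω
  norm_le : ∀ p ∈ Ω, ∀ y, ‖Φ (p, y)‖ ≤ M p
  lipschitz : ∀ p ∈ Ω, ∀ y y', ‖Φ (p, y) - Φ (p, y')‖ ≤ M p * |y - y'|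
  symm : ∀ p ∈ Ω, ∀ y, ∀ v w, fderiv ℝ Φ (p, y) (v, Φ (p, y) v) w =
    fderiv ℝ Φ (p, y) (w, Φ (p, y) w) v

theorem hasDerivAt_ray {E : Type*} [NormedAddCommGroup E] [NormedSpace ℝ E] (c v : E) (s : ℝ) :
    HasDerivAt (fun s : ℝ => c + s • v) v s := by
  simpa using ((hasDerivAt_id s).smul_const v).const_add c

/-- On each segment from `c` the difference of the solutions satisfies |f'| ≤ K |f| with f(0) = 0.
-/
theorem eqOn_of_total_differential {E : Type*} [NormedAddCommGroup E] [NormedSpace ℝ E]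
    {Ω : Set E} {c : E} (hstar : IsStar c Ω) {Φ : E × ℝ → E →L[ℝ] ℝ} {M : E → ℝ}
    (hΦ : IsIntegrable Ω Φ M) {y z : E → ℝ} (hy : ∀ p ∈ Ω, HasFDerivAt y (Φ (p, y p)) p)
    (hz : ∀ p ∈ Ω, HasFDerivAt z (Φ (p, z p)) p) (h0 : y c = z c) : EqOn y z Ω := by
  intro p hp
  have hcont : ContinuousOn (fun s : ℝ => M (c + s • (p - c))) (Icc 0 1) :=
    hΦ.continuousOn_bound.comp (by fun_prop) fun s hs => hstar p hp s hs
  obtain ⟨B, hB⟩ := isCompact_Icc.exists_bound_of_continuousOn hcont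
  have key := eq_zero_of_abs_deriv_le_mul_abs_self_of_eq_zero_right
    (f := fun s : ℝ => y (c + s • (p - c)) - z (c + s • (p - c)))
    (f' := fun s : ℝ => Φ (c + s • (p - c), y (c + s • (p - c))) (p - c) -
      Φ (c + s • (p - c), z (c + s • (p - c))) (p - c))
    (K := B * ‖p - c‖) (a := 0) (b := 1) ?_ ?_ ?_ ?_ 1 (by simp)
  · simpa [sub_eq_zero] using key
  · intro s hs
    exact (((hy _ (hstar p hp s hs)).comp_hasDerivAt s (hasDerivAt_ray c (p - c) s)).sub
      ((hz _ (hstar p hp s hs)).comp_hasDerivAt s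
        (hasDerivAt_ray c (p - c) s))).continuousAt.continuousWithinAt
  · intro s hs
    have hs' := Ico_subset_Icc_self hs
    exact (((hy _ (hstar p hp s hs')).comp_hasDerivAt s (hasDerivAt_ray c (p - c) s)).sub
      ((hz _ (hstar p hp s hs')).comp_hasDerivAt s
        (hasDerivAt_ray c (p - c) s))).hasDerivWithinAt
  · simp [h0]
  · intro s hs
    have hs' := Ico_subset_Icc_self hs
    rw [← sub_apply]
    refine (ContinuousLinearMap.le_opNorm _ _).trans ?_
    have h1 := hΦ.lipschitz _ (hstar p hp s hs') (y (c + s • (p - c))) (z (c + s • (p - c)))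
    have h2 := (le_abs_self _).trans (hB s hs')
    have h3 : ‖Φ (c + s • (p - c), y (c + s • (p - c))) -
        Φ (c + s • (p - c), z (c + s • (p - c)))‖ ≤
        B * ‖y (c + s • (p - c)) - z (c + s • (p - c))‖ :=
      h1.trans (mul_le_mul_of_nonneg_right h2 (abs_nonneg _))
    calc _ ≤ _ := mul_le_mul_of_nonneg_right h3 (norm_nonneg _)
      _ = _ := by ring

/-- Bootstrap: the derivative Φ(p, y p) is as regular as y, so y gains one order at each step. -/
theorem contDiffOn_of_total_differential {E : Type*} [NormedAddCommGroup E] [NormedSpace ℝ E]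
    {Ω : Set E} (hΩ : IsOpen Ω) {Φ : E × ℝ → E →L[ℝ] ℝ} (hΦ : ContDiffOn ℝ ∞ Φ (Ω ×ˢ univ))
    {y : E → ℝ} (hy : ∀ p ∈ Ω, HasFDerivAt y (Φ (p, y p)) p) : ContDiffOn ℝ ∞ y Ω := by
  rw [contDiffOn_infty]
  intro n
  induction n with
  | zero =>
    exact contDiffOn_zero.2 fun p hp => (hy p hp).continuousAt.continuousWithinAt
  | succ n ih =>
    have : ((n + 1 : ℕ) : WithTop ℕ∞) = (n : WithTop ℕ∞) + 1 := by norm_cast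
    rw [this, contDiffOn_succ_iff_fderiv_of_isOpen hΩ]
    refine ⟨fun p hp => (hy p hp).differentiableAt.differentiableWithinAt, by simp, ?_⟩
    have h1 : ContDiffOn ℝ n (fun p => Φ (p, y p)) Ω :=
      (hΦ.of_le (mod_cast le_top)).comp (contDiffOn_id.prodMk ih) fun p hp => ⟨hp, mem_univ _⟩
    exact h1.congr fun p hp => (hy p hp).fderiv

/-- Solve the ordinary equation along every ray from `c` and take the value at time 1. The
integrability condition says that s Φ(c + s(p − c), Y) solves the variational equation of this
family of equations, so the differential of the value at time 1 is Φ(p, y p). -/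
theorem exists_total_differential {E : Type*} [NormedAddCommGroup E] [NormedSpace ℝ E]
    [FiniteDimensional ℝ E] {Ω : Set E} (hΩ : IsOpen Ω) {c : E} (hc : c ∈ Ω) (hstar : IsStar c Ω)
    {Φ : E × ℝ → E →L[ℝ] ℝ} {M : E → ℝ} (hΦ : IsIntegrable Ω Φ M) :
    ∃ y : E → ℝ, y c = 0 ∧ ∀ p ∈ Ω, HasFDerivAt y (Φ (p, y p)) p := by
  have : ProperSpace E := FiniteDimensional.proper ℝ E
  set Ψ : ℝ × E × ℝ → ℝ := fun x => Φ (c + x.1 • (x.2.1 - c), x.2.2) (x.2.1 - c) with hΨ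
  have hM0 : ∀ p ∈ Ω, 0 ≤ M p := fun p hp => (norm_nonneg _).trans (hΦ.norm_le p hp 0)
  have hΨle : ∀ s ∈ Icc (0 : ℝ) 1, ∀ q ∈ Ω, ∀ y,
      |Ψ (s, q, y)| ≤ M (c + s • (q - c)) * ‖q - c‖ := fun s hs q hq y =>
    ((Φ (c + s • (q - c), y)).le_opNorm _).trans
      (mul_le_mul_of_nonneg_right (hΦ.norm_le _ (hstar q hq s hs) y) (norm_nonneg _))
  have hΩ' : ∀ q ∈ Ω, ∀ y : ℝ, Ω ×ˢ (univ : Set ℝ) ∈ 𝓝 (q, y) := fun q hq y =>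
    (hΩ.prod isOpen_univ).mem_nhds ⟨hq, mem_univ y⟩
  have hex : ∀ q ∈ Ω, ∃ Y : ℝ → ℝ, Y 0 = 0 ∧
      ∀ s ∈ Icc (0 : ℝ) 1, HasDerivWithinAt Y (Ψ (s, q, Y s)) (Icc 0 1) s := by
    intro q hq
    have hcont : ContinuousOn (fun s : ℝ => M (c + s • (q - c)) * ‖q - c‖) (Icc 0 1) :=
      (hΦ.continuousOn_bound.comp (by fun_prop) fun s hs => hstar q hq s hs).mul_const _
    obtain ⟨L, hL⟩ := isCompact_Icc.exists_bound_of_continuousOn hcont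
    have hL' : ∀ s ∈ Icc (0 : ℝ) 1, M (c + s • (q - c)) * ‖q - c‖ ≤ L.toNNReal := fun s hs =>
      ((le_abs_self _).trans (hL s hs)).trans (Real.le_coe_toNNReal L)
    -- The speed is at most L, so in unit time a solution starting at 0 stays within radius L; hence
    -- it exists on all of [0, 1].
    have hPL : IsPicardLindelof (fun s y => Ψ (s, q, y)) (tmin := 0) (tmax := 1)
        (⟨0, by simp⟩ : Icc (0 : ℝ) 1) (0 : ℝ) L.toNNReal 0 L.toNNReal L.toNNReal := by
      refine ⟨fun s hs => LipschitzOnWith.of_dist_le_mul fun y _ y' _ => ?_, fun y _ => ?_,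
        fun s hs y _ => (hΨle s hs q hq y).trans (hL' s hs), by simp⟩
      · rw [Real.dist_eq, Real.dist_eq]
        have h1 := hΦ.lipschitz _ (hstar q hq s hs) y y'
        have h2 := (Φ (c + s • (q - c), y) - Φ (c + s • (q - c), y')).le_opNorm (q - c)
        calc |Ψ (s, q, y) - Ψ (s, q, y')|
            ≤ ‖Φ (c + s • (q - c), y) - Φ (c + s • (q - c), y')‖ * ‖q - c‖ := h2
          _ ≤ (M (c + s • (q - c)) * |y - y'|) * ‖q - c‖ := by gcongr
          _ = (M (c + s • (q - c)) * ‖q - c‖) * |y - y'| := by ring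
          _ ≤ _ := mul_le_mul_of_nonneg_right (hL' s hs) (abs_nonneg _)
      · refine ContinuousOn.clm_apply ?_ (continuousOn_const (c := q - c))
        exact hΦ.smooth.continuousOn.comp (by fun_prop) fun s hs => ⟨hstar q hq s hs, mem_univ _⟩
    exact hPL.exists_eq_forall_mem_Icc_hasDerivWithinAt₀
  choose! Y hY0 hY using hex
  refine ⟨fun q => Y q 1, ?_, fun p hp => ?_⟩
  · have := abs_le_gronwallBound_of_unit_interval le_rfl le_rfl (hY0 c hc) (hY c hc)
      (fun s hs => by simp [hΨ]) 1 (by simp)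
    simpa using this
  · obtain ⟨δ, hδ, hδΩ⟩ := nhds_basis_closedBall.mem_iff.1 (hΩ.mem_nhds hp)
    have hcont : ContinuousOn (fun x : ℝ × E => M (c + x.1 • (x.2 - c)) * ‖x.2 - c‖)
        (Icc 0 1 ×ˢ closedBall p δ) :=
      (hΦ.continuousOn_bound.comp (by fun_prop)
        fun x hx => hstar x.2 (hδΩ hx.2) x.1 hx.1).mul (by fun_prop)
    obtain ⟨B, hB⟩ := (isCompact_Icc.prod (isCompact_closedBall p δ)).exists_bound_of_continuousOn
      hcont
    have hYB : ∀ q ∈ closedBall p δ, ∀ s ∈ Icc (0 : ℝ) 1, Y q s ∈ Icc (-B) B := by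
      intro q hq s hs
      have h0B : 0 ≤ B := (norm_nonneg _).trans (hB (s, q) ⟨hs, hq⟩)
      have h1 := (convex_Icc (0 : ℝ) 1).norm_image_sub_le_of_norm_hasDerivWithin_le
        (C := B) (hY q (hδΩ hq)) (fun r hr => (hΨle r hr q (hδΩ hq) _).trans
          ((le_abs_self _).trans (hB (r, q) ⟨hr, hq⟩))) (left_mem_Icc.2 zero_le_one) hs
      rw [hY0 q (hδΩ hq), sub_zero, sub_zero, Real.norm_eq_abs, Real.norm_eq_abs,
        abs_of_nonneg hs.1] at h1
      exact abs_le.1 (h1.trans (mul_le_of_le_one_right h0B hs.2))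
    have hΦd : ∀ q ∈ Ω, ∀ y, HasFDerivAt Φ (fderiv ℝ Φ (q, y)) (q, y) := fun q hq y =>
      ((hΦ.smooth.contDiffAt (hΩ' q hq y)).differentiableAt (by simp)).hasFDerivAt
    have hΨd : ∀ s ∈ Icc (0 : ℝ) 1, ∀ y h k, fderiv ℝ Ψ (s, p, y) (0, h, k) =
        fderiv ℝ Φ (c + s • (p - c), y) (s • h, k) (p - c) + Φ (c + s • (p - c), y) h := by
      intro s hs y h k
      have h1 := ((ContinuousLinearMap.fst ℝ E ℝ).comp
        (ContinuousLinearMap.snd ℝ ℝ (E × ℝ))).hasFDerivAt (x := (s, p, y))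
      have h1' := ((ContinuousLinearMap.snd ℝ E ℝ).comp
        (ContinuousLinearMap.snd ℝ ℝ (E × ℝ))).hasFDerivAt (x := (s, p, y))
      have h2 := h1.sub_const c
      have hg := (((ContinuousLinearMap.fst ℝ ℝ (E × ℝ)).hasFDerivAt.fun_smul h2).const_add
        c).prodMk h1'
      have h3 := HasFDerivAt.clm_apply (HasFDerivAt.comp (s, p, y)
        (g := Φ) (hΦd _ (hstar p hp s hs) y) hg) h2
      have h4 : fderiv ℝ Ψ (s, p, y) = _ := h3.fderiv
      rw [h4]
      simp [add_comm]
    have hmain := hasFDerivAt_endpoint (Ψ := Ψ) (Y := Y) (p := p)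
      (Z := fun s => s • Φ (c + s • (p - c), Y p s)) hδ ?_ hYB (fun q hq => hY0 q (hδΩ hq))
      (fun q hq => hY q (hδΩ hq)) (by simp) ?_
    · simpa using hmain
    · rintro ⟨s, q, y⟩ ⟨hs, hq, -⟩
      have h1 : ContDiffAt ℝ 1 Φ (c + s • (q - c), y) :=
        (hΦ.smooth.contDiffAt (hΩ' _ (hstar q (hδΩ hq) s hs) y)).of_le (by simp)
      have h2 : ContDiff ℝ 1 fun x : ℝ × E × ℝ => (c + x.1 • (x.2.1 - c), x.2.2) := by fun_prop
      have h3 : ContDiff ℝ 1 fun x : ℝ × E × ℝ => x.2.1 - c := by fun_prop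
      have h4 : ContDiffAt ℝ 1 (fun x : ℝ × E × ℝ => Φ (c + x.1 • (x.2.1 - c), x.2.2))
          (s, q, y) :=
        ContDiffAt.comp (s, q, y) (f := fun x : ℝ × E × ℝ => (c + x.1 • (x.2.1 - c), x.2.2))
          h1 h2.contDiffAt
      exact h4.clm_apply h3.contDiffAt
    · intro h s hs
      have hγ : HasDerivWithinAt (fun s => (c + s • (p - c), Y p s))
          (p - c, Ψ (s, p, Y p s)) (Icc 0 1) s :=
        (hasDerivAt_ray c (p - c) s).hasDerivWithinAt.prodMk (hY p hp s hs)
      have h0 : HasDerivWithinAt (fun s => Φ (c + s • (p - c), Y p s))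
          (fderiv ℝ Φ (c + s • (p - c), Y p s) (p - c, Ψ (s, p, Y p s))) (Icc 0 1) s :=
        HasFDerivAt.comp_hasDerivWithinAt (f := fun s => (c + s • (p - c), Y p s)) s
          (hΦd _ (hstar p hp s hs) (Y p s)) hγ
      have h1 : HasDerivWithinAt (fun s => Φ (c + s • (p - c), Y p s) h)
          (fderiv ℝ Φ (c + s • (p - c), Y p s) (p - c, Ψ (s, p, Y p s)) h) (Icc 0 1) s :=
        (ContinuousLinearMap.apply ℝ ℝ h).hasFDerivAt.comp_hasDerivWithinAt s h0
      have h2 := (hasDerivWithinAt_id s (Icc 0 1)).mul h1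
      rw [hΨd s hs]
      -- This is s times a direction tangent to dy = Φ, so `symm` may exchange h and p − c. What
      -- remains is the product rule for s Φ(c + s(p − c), Y) h.
      have h3 : (s • h, (s • Φ (c + s • (p - c), Y p s)) h) =
          s • (h, Φ (c + s • (p - c), Y p s) h) := by simp
      rw [h3, map_smul, smul_apply, hΦ.symm _ (hstar p hp s hs)]
      refine h2.congr_deriv ?_
      simp [hΨ, add_comm]

/-! ### The pulled-back forms -/

/-- The inclusion `incl` as a continuous linear map. -/
noncomputable def inclL (n : ℕ) : Base n →L[ℝ] Base (n + 1) :=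
  LinearMap.toContinuousLinearMap
    { toFun := incl
      map_add' := fun p q => by
        ext i; refine Fin.lastCases ?_ (fun j => ?_) i <;> simp [incl]
      map_smul' := fun s p => by
        ext i; refine Fin.lastCases ?_ (fun j => ?_) i <;> simp [incl] }

@[simp] theorem inclL_apply {n : ℕ} (p : Base n) : inclL n p = incl p := rfl

theorem incl_single_zero (n : ℕ) : incl (Pi.single 0 1 : Base n) = Pi.single 0 1 := by
  ext i
  refine Fin.lastCases ?_ (fun j => ?_) i
  · simp [incl, Fin.ext_iff]
  · simp only [incl, Fin.snoc_castSucc, Pi.single_apply]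
    exact if_congr (Fin.castSucc_eq_zero_iff (a := j)).symm rfl rfl

/-- One-forms on an open set which satisfy the structure equations of a metric of
curvature `-1`. -/
structure IsCoframe {E : Type*} [NormedAddCommGroup E] [NormedSpace ℝ E] (W : Set E)
    (w : Fin 3 → E → E →L[ℝ] ℝ) : Prop where
  isOpen : IsOpen W
  smooth : ∀ α, ContDiffOn ℝ ∞ (w α) W
  structure_one : ∀ p ∈ W, ∀ x y,
    fderiv ℝ (w 0) p x y - fderiv ℝ (w 0) p y x = w 2 p x * w 1 p y - w 2 p y * w 1 p x
  structure_two : ∀ p ∈ W, ∀ x y,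
    fderiv ℝ (w 1) p x y - fderiv ℝ (w 1) p y x = w 0 p x * w 2 p y - w 0 p y * w 2 p x
  structure_three : ∀ p ∈ W, ∀ x y,
    fderiv ℝ (w 2) p x y - fderiv ℝ (w 2) p y x = w 0 p x * w 1 p y - w 0 p y * w 1 p x

/-- Coframes on nested open sets `dom n` of `ℝ^{n+2}` which restrict to each other. -/
structure IsCoframeSequence (dom : (n : ℕ) → Set (Base n))
    (w : (n : ℕ) → Fin 3 → Base n → Base n →L[ℝ] ℝ) : Prop where
  nonempty_dom : (dom 0).Nonempty
  dom_incl : ∀ n, ∀ p ∈ dom n, incl p ∈ dom (n + 1)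
  coframe : ∀ n, IsCoframe (dom n) (w n)
  restrict : ∀ n α, ∀ p ∈ dom n, (w (n + 1) α (incl p)).comp (inclL n) = w n α p
  nondegenerate : ∀ p ∈ dom 0, ∀ x, w 0 0 p x = 0 → w 0 1 p x = 0 → x = 0

theorem pullForm_apply {θ : Fin 3 → ℕ → Jet → ℝ} {n : ℕ} (v : Base n → ℝ) (α : Fin 3)
    (p x : Base n) : pullForm θ v α p x = ∑ a, coeffAt θ v α p a * x a := by
  simp [pullForm, sum_apply]

theorem fderiv_eq_sum_pd {n : ℕ} (g : Base n → ℝ) (p x : Base n) :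
    fderiv ℝ g p x = ∑ b, x b * pd b g p := by
  conv_lhs => rw [← Finset.univ_sum_single x, map_sum]
  refine Finset.sum_congr rfl fun b _ => ?_
  have : (Pi.single b (x b) : Base n) = x b • Pi.single b 1 := by
    rw [← Pi.single_smul, smul_eq_mul, mul_one]
  rw [this, map_smul, smul_eq_mul, pd]

section

variable {D : Set Jet} {F : ℕ → Jet → ℝ} {θ : Fin 3 → ℕ → Jet → ℝ}
  {dom : (n : ℕ) → Set (Base n)} {u : (n : ℕ) → Base n → ℝ}

theorem contDiffOn_coeff (hF : IsHierarchy D F θ) (hu : IsSolution D F dom u) (n : ℕ)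
    (α : Fin 3) (a : Fin (n + 2)) :
    ContDiffOn ℝ ∞ (fun p => coeffAt θ (u n) α p a) (dom n) :=
  contDiffOn_comp_jet (hF.diffFun_coeff α a) (hu.isOpen_dom n) (hu.smooth n) (hu.jet_mem n)

theorem contDiffOn_pullForm (hF : IsHierarchy D F θ) (hu : IsSolution D F dom u) (n : ℕ)
    (α : Fin 3) : ContDiffOn ℝ ∞ (pullForm θ (u n) α) (dom n) :=
  ContDiffOn.sum fun a _ => (contDiffOn_coeff hF hu n α a).smul contDiffOn_const

theorem fderiv_pullForm (hF : IsHierarchy D F θ) (hu : IsSolution D F dom u) {n : ℕ}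
    (α : Fin 3) {p : Base n} (hp : p ∈ dom n) (x y : Base n) :
    fderiv ℝ (pullForm θ (u n) α) p x y =
      ∑ b, ∑ a, x b * y a * totalD F b (Theta θ n α a) (jet (u n) p) := by
  have hnhds := (hu.isOpen_dom n).mem_nhds hp
  have h1 : fderiv ℝ (pullForm θ (u n) α) p x y =
      fderiv ℝ (fun q => pullForm θ (u n) α q y) p x := by
    have hd : DifferentiableAt ℝ (pullForm θ (u n) α) p :=
      ((contDiffOn_pullForm hF hu n α).contDiffAt hnhds).differentiableAt (by simp)
    rw [(hd.hasFDerivAt.clm_apply (hasFDerivAt_const y p)).fderiv]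
    simp
  have h2 : ∀ a, HasFDerivAt (fun q => coeffAt θ (u n) α q a)
      (fderiv ℝ (fun q => coeffAt θ (u n) α q a) p) p := fun a =>
    (((contDiffOn_coeff hF hu n α a).contDiffAt hnhds).differentiableAt (by simp)).hasFDerivAt
  have h3 : HasFDerivAt (fun q => pullForm θ (u n) α q y)
      (∑ a, y a • fderiv ℝ (fun q => coeffAt θ (u n) α q a) p) p := by
    simp only [pullForm_apply]
    exact HasFDerivAt.fun_sum fun a _ => (h2 a).mul_const (y a)
  rw [h1, h3.fderiv, sum_apply, Finset.sum_comm]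
  refine Finset.sum_congr rfl fun a _ => ?_
  rw [smul_apply, fderiv_eq_sum_pd, smul_eq_mul, Finset.mul_sum]
  refine Finset.sum_congr rfl fun b _ => ?_
  have := pd_comp_jet_of_solution hF.isOpen_domain hF.diffFun_rhs (hF.diffFun_coeff α a)
    (hu.isOpen_dom n) (hu.smooth n) (hu.jet_mem n) (hu.solves n) hp b
  change _ * (_ * pd b (fun q => θ α a (jet (u n) q)) p) = _
  rw [this]
  simp only [Theta]
  ring

/-- On a solution d_H becomes the exterior derivative, here the antisymmetrized `fderiv`. -/
theorem structure_pullForm (hF : IsHierarchy D F θ) (hu : IsSolution D F dom u) {n : ℕ}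
    {α β γ : Fin 3} {p : Base n} (hp : p ∈ dom n)
    (h : ∀ a b, dH F (Theta θ n α) a b (jet (u n) p) =
      wedge (fun c => Theta θ n β c (jet (u n) p)) (fun c => Theta θ n γ c (jet (u n) p)) a b)
    (x y : Base n) :
    fderiv ℝ (pullForm θ (u n) α) p x y - fderiv ℝ (pullForm θ (u n) α) p y x =
      pullForm θ (u n) β p x * pullForm θ (u n) γ p y -
        pullForm θ (u n) β p y * pullForm θ (u n) γ p x := by
  rw [fderiv_pullForm hF hu α hp x y, fderiv_pullForm hF hu α hp y x,
    Finset.sum_comm (f := fun b a => y b * x a * _), ← Finset.sum_sub_distrib,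
    mul_comm (pullForm θ (u n) β p y)]
  simp only [← Finset.sum_sub_distrib, pullForm_apply, Finset.sum_mul_sum]
  refine Finset.sum_congr rfl fun b _ => Finset.sum_congr rfl fun a _ => ?_
  have := h b a
  simp only [dH, wedge] at this
  simp only [coeffAt]
  linear_combination (x b * y a) * this

/-- The x-direction is tangent to the hyperplane τ_{n+1} = 0, so x-derivatives commute with
restriction to it. -/
theorem iterate_pd_incl (hu : IsSolution D F dom u) (n j : ℕ) :
    ∀ p ∈ dom n, ((pd 0)^[j] (u (n + 1))) (incl p) = ((pd 0)^[j] (u n)) p := by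
  induction j with
  | zero => exact hu.restrict n
  | succ j ih =>
    intro p hp
    simp only [Function.iterate_succ_apply', pd]
    have hd : DifferentiableAt ℝ ((pd 0)^[j] (u (n + 1))) (inclL n p) :=
      ((contDiffOn_iterate_pd (hu.isOpen_dom _) (hu.smooth _) j).contDiffAt
        ((hu.isOpen_dom _).mem_nhds (hu.dom_incl n p hp))).differentiableAt (by simp)
    have h1 := hd.hasFDerivAt.comp p (inclL n).hasFDerivAt
    have h2 : ((pd 0)^[j] (u n)) =ᶠ[𝓝 p] ((pd 0)^[j] (u (n + 1))) ∘ inclL n := by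
      filter_upwards [(hu.isOpen_dom n).mem_nhds hp] with q hq using (ih q hq).symm
    rw [h2.fderiv_eq, h1.fderiv]
    simp [incl_single_zero]

theorem jet_incl (hu : IsSolution D F dom u) {n : ℕ} {p : Base n} (hp : p ∈ dom n) :
    jet (u (n + 1)) (incl p) = jet (u n) p := by
  refine Prod.ext (funext fun a => ?_) (funext fun j => iterate_pd_incl hu n j p hp)
  simp only [jet]
  by_cases h : a < n + 2
  · have h' : a < n + 1 + 2 := by omega
    rw [dif_pos h, dif_pos h']
    exact Fin.snoc_castSucc (α := fun _ => ℝ) 0 p ⟨a, h⟩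
  · rw [dif_neg h]
    split_ifs with h'
    -- This is a = n + 2, the variable τ_{n+1}: the inclusion sets it to 0, which is also the
    -- default value used by `jet` at level n.
    · have : (⟨a, h'⟩ : Fin (n + 1 + 2)) = Fin.last (n + 2) := Fin.ext (by simp; omega)
      rw [this]
      exact Fin.snoc_last (α := fun _ => ℝ) 0 p
    · rfl

theorem isCoframeSequence_pullForm (hF : IsHierarchy D F θ) (hu : IsSolution D F dom u)
    (hgen : IsIIIGeneric θ (dom 0) (u 0)) :
    IsCoframeSequence dom fun n => pullForm θ (u n) where
  nonempty_dom := hu.nonempty_dom 0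
  dom_incl := hu.dom_incl
  coframe n :=
    { isOpen := hu.isOpen_dom n
      smooth := contDiffOn_pullForm hF hu n
      structure_one := fun p hp => structure_pullForm hF hu hp
        (hF.structure_one n _ (hu.jet_mem n p hp))
      structure_two := fun p hp => structure_pullForm hF hu hp
        (hF.structure_two n _ (hu.jet_mem n p hp))
      structure_three := fun p hp => structure_pullForm hF hu hp
        (hF.structure_three n _ (hu.jet_mem n p hp)) }
  restrict n α p hp := by
    ext x
    rw [ContinuousLinearMap.comp_apply, pullForm_apply, pullForm_apply, Fin.sum_univ_castSucc]
    have hj := jet_incl hu hp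
    simp only [incl] at hj
    simp [coeffAt, hj, incl, Theta]
  nondegenerate p hp x h0 h1 := by
    rw [pullForm_apply, Fin.sum_univ_two] at h0 h1
    set φ := coeffAt θ (u 0) 0 p
    set ψ := coeffAt θ (u 0) 1 p
    -- In the plane every component of the wedge product is 0 or ± this determinant; Cramer's rule
    -- then gives x = 0.
    have hdet : φ 0 * ψ 1 - φ 1 * ψ 0 ≠ 0 := by
      intro hz
      refine hgen p hp (funext fun a => funext fun b => ?_)
      simp only [wedge, Pi.zero_apply]
      fin_cases a <;> fin_cases b <;> simp <;> linarith
    have hx0 : (φ 0 * ψ 1 - φ 1 * ψ 0) * x 0 = 0 := by linear_combination ψ 1 * h0 - φ 1 * h1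
    have hx1 : (φ 0 * ψ 1 - φ 1 * ψ 0) * x 1 = 0 := by linear_combination φ 0 * h1 - ψ 0 * h0
    ext i
    fin_cases i
    · simpa using (mul_eq_zero.1 hx0).resolve_left hdet
    · simpa using (mul_eq_zero.1 hx1).resolve_left hdet

end

/-! ### Normal form of a coframe -/

section

variable {E : Type*} [NormedAddCommGroup E] [NormedSpace ℝ E]

/-- `μ` rotates the coframe `w` into the coframe `exp (-b) da`, `db` of the hyperbolic plane. -/
structure IsNormalForm (c : E) (W : Set E) (w : Fin 3 → E → E →L[ℝ] ℝ) (μ b a : E → ℝ) :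
    Prop where
  angle_center : μ c = 0
  height_center : b c = 0
  width_center : a c = 0
  angle : ∀ p ∈ W, HasFDerivAt μ
    (Real.cos (μ p) • w 0 p + Real.sin (μ p) • w 1 p - w 2 p) p
  height : ∀ p ∈ W, HasFDerivAt b (-Real.sin (μ p) • w 0 p + Real.cos (μ p) • w 1 p) p
  width : ∀ p ∈ W, HasFDerivAt a
    (Real.exp (b p) • (Real.cos (μ p) • w 0 p + Real.sin (μ p) • w 1 p)) p

variable {c : E} {W : Set E} {w : Fin 3 → E → E →L[ℝ] ℝ}

theorem IsCoframe.hasFDerivAt (hw : IsCoframe W w) {p : E} (hp : p ∈ W) (α : Fin 3) :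
    HasFDerivAt (w α) (fderiv ℝ (w α) p) p :=
  (((hw.smooth α).contDiffAt (hw.isOpen.mem_nhds hp)).differentiableAt (by simp)).hasFDerivAt

theorem IsCoframe.mono (hw : IsCoframe W w) {V : Set E} (hV : IsOpen V) (hVW : V ⊆ W) :
    IsCoframe V w where
  isOpen := hV
  smooth α := (hw.smooth α).mono hVW
  structure_one p hp := hw.structure_one p (hVW hp)
  structure_two p hp := hw.structure_two p (hVW hp)
  structure_three p hp := hw.structure_three p (hVW hp)

/-- The Frobenius condition is the combination of the structure equations with weights cos y, sin y,
−1, together with sin² + cos² = 1. Since sin and cos are bounded and 1-Lipschitz, the bounds are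
uniform in y. -/
theorem IsCoframe.isIntegrable_angle (hw : IsCoframe W w) :
    IsIntegrable W (fun x : E × ℝ => Real.cos x.2 • w 0 x.1 + Real.sin x.2 • w 1 x.1 - w 2 x.1)
      (fun p => ‖w 0 p‖ + ‖w 1 p‖ + ‖w 2 p‖) where
  smooth := by
    have h : ∀ α, ContDiffOn ℝ ∞ (fun x : E × ℝ => w α x.1) (W ×ˢ univ) := fun α =>
      (hw.smooth α).comp contDiffOn_fst fun x hx => hx.1
    have hc : ContDiffOn ℝ ∞ (fun x : E × ℝ => Real.cos x.2) (W ×ˢ univ) :=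
      (Real.contDiff_cos.comp contDiff_snd).contDiffOn
    have hs : ContDiffOn ℝ ∞ (fun x : E × ℝ => Real.sin x.2) (W ×ˢ univ) :=
      (Real.contDiff_sin.comp contDiff_snd).contDiffOn
    exact ((hc.smul (h 0)).add (hs.smul (h 1))).sub (h 2)
  continuousOn_bound :=
    ((hw.smooth 0).continuousOn.norm.add (hw.smooth 1).continuousOn.norm).add
      (hw.smooth 2).continuousOn.norm
  norm_le p _ y := by
    refine (norm_sub_le _ _).trans (add_le_add_left ((norm_add_le _ _).trans ?_) _)
    rw [norm_smul, norm_smul]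
    exact add_le_add (mul_le_of_le_one_left (norm_nonneg _) (Real.abs_cos_le_one y))
      (mul_le_of_le_one_left (norm_nonneg _) (Real.abs_sin_le_one y))
  lipschitz p _ y y' := by
    have : Real.cos y • w 0 p + Real.sin y • w 1 p - w 2 p -
        (Real.cos y' • w 0 p + Real.sin y' • w 1 p - w 2 p) =
        (Real.cos y - Real.cos y') • w 0 p + (Real.sin y - Real.sin y') • w 1 p := by
      module
    simp only [this]
    refine (norm_add_le _ _).trans ?_
    rw [norm_smul, norm_smul, Real.norm_eq_abs, Real.norm_eq_abs]
    have h0 := mul_le_mul_of_nonneg_right (Real.abs_cos_sub_cos_le y y') (norm_nonneg (w 0 p))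
    have h1 := mul_le_mul_of_nonneg_right (Real.abs_sin_sub_sin_le y y') (norm_nonneg (w 1 p))
    have h2 := mul_nonneg (norm_nonneg (w 2 p)) (abs_nonneg (y - y'))
    linarith
  symm p hp y v x := by
    have hd : ∀ α, HasFDerivAt (fun z : E × ℝ => w α z.1)
        ((fderiv ℝ (w α) p).comp (ContinuousLinearMap.fst ℝ E ℝ)) (p, y) := fun α =>
      HasFDerivAt.comp (p, y) (f := Prod.fst) (hw.hasFDerivAt hp α) hasFDerivAt_fst
    have hs := (hasFDerivAt_snd (𝕜 := ℝ) (p := (p, y))).sin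
    have hc := (hasFDerivAt_snd (𝕜 := ℝ) (p := (p, y))).cos
    have hΦ := ((hc.fun_smul (hd 0)).fun_add (hs.fun_smul (hd 1))).fun_sub (hd 2)
    rw [hΦ.fderiv]
    simp
    have h1 := hw.structure_one p hp v x
    have h2 := hw.structure_two p hp v x
    have h3 := hw.structure_three p hp v x
    have := Real.sin_sq_add_cos_sq y
    linear_combination Real.cos y * h1 + Real.sin y * h2 - h3 +
      (w 0 p v * w 1 p x - w 0 p x * w 1 p v) * this

/-- A right-hand side independent of y: the Poincaré lemma as a case of Frobenius. -/
theorem isIntegrable_of_closed (hW : IsOpen W) {η : E → E →L[ℝ] ℝ} (hη : ContDiffOn ℝ ∞ η W)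
    (hsymm : ∀ p ∈ W, ∀ v x, fderiv ℝ η p v x = fderiv ℝ η p x v) :
    IsIntegrable W (fun z : E × ℝ => η z.1) fun p => ‖η p‖ where
  smooth := hη.comp contDiffOn_fst fun x hx => hx.1
  continuousOn_bound := hη.continuousOn.norm
  norm_le _ _ _ := le_rfl
  lipschitz p _ y y' := by simpa using mul_nonneg (norm_nonneg _) (abs_nonneg _)
  symm p hp y v x := by
    have h : HasFDerivAt (fun z : E × ℝ => η z.1)
        ((fderiv ℝ η p).comp (ContinuousLinearMap.fst ℝ E ℝ)) (p, y) :=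
      HasFDerivAt.comp (p, y) (f := Prod.fst)
        ((hη.contDiffAt (hW.mem_nhds hp)).differentiableAt (by simp)).hasFDerivAt hasFDerivAt_fst
    rw [h.fderiv]
    simpa using hsymm p hp v x

/-- With dμ = η − w₃, the terms of dξ from dμ add up to w₃ ∧ η, and those from the structure
equations to −w₃ ∧ η; thus ξ is closed. -/
theorem IsCoframe.isIntegrable_height (hw : IsCoframe W w) {μ : E → ℝ} (hμs : ContDiffOn ℝ ∞ μ W)
    (hμ : ∀ p ∈ W, HasFDerivAt μ
      (Real.cos (μ p) • w 0 p + Real.sin (μ p) • w 1 p - w 2 p) p) :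
    IsIntegrable W (fun z : E × ℝ => -Real.sin (μ z.1) • w 0 z.1 + Real.cos (μ z.1) • w 1 z.1)
      fun p => ‖-Real.sin (μ p) • w 0 p + Real.cos (μ p) • w 1 p‖ := by
  refine isIntegrable_of_closed (η := fun p => -Real.sin (μ p) • w 0 p + Real.cos (μ p) • w 1 p)
    hw.isOpen ?_ fun p hp v x => ?_
  · exact (hμs.sin.neg.smul (hw.smooth 0)).add (hμs.cos.smul (hw.smooth 1))
  · rw [(((hμ p hp).sin.fun_neg.fun_smul (hw.hasFDerivAt hp 0)).fun_add
      ((hμ p hp).cos.fun_smul (hw.hasFDerivAt hp 1))).fderiv]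
    simp
    have h1 := hw.structure_one p hp v x
    have h2 := hw.structure_two p hp v x
    linear_combination -Real.sin (μ p) * h1 + Real.cos (μ p) * h2

/-- Since η and w₃ differ by dμ, dη = w₁ ∧ w₂ = η ∧ ξ; as db = ξ, the factor exp b makes η closed.
-/
theorem IsCoframe.isIntegrable_width (hw : IsCoframe W w) {μ b : E → ℝ}
    (hμs : ContDiffOn ℝ ∞ μ W) (hbs : ContDiffOn ℝ ∞ b W)
    (hμ : ∀ p ∈ W, HasFDerivAt μ
      (Real.cos (μ p) • w 0 p + Real.sin (μ p) • w 1 p - w 2 p) p)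
    (hb : ∀ p ∈ W, HasFDerivAt b (-Real.sin (μ p) • w 0 p + Real.cos (μ p) • w 1 p) p) :
    IsIntegrable W (fun z : E × ℝ => Real.exp (b z.1) •
        (Real.cos (μ z.1) • w 0 z.1 + Real.sin (μ z.1) • w 1 z.1))
      fun p => ‖Real.exp (b p) • (Real.cos (μ p) • w 0 p + Real.sin (μ p) • w 1 p)‖ := by
  refine isIntegrable_of_closed
    (η := fun p => Real.exp (b p) • (Real.cos (μ p) • w 0 p + Real.sin (μ p) • w 1 p))
    hw.isOpen ?_ fun p hp v x => ?_
  · exact hbs.exp.smul ((hμs.cos.smul (hw.smooth 0)).add (hμs.sin.smul (hw.smooth 1)))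
  · rw [((hb p hp).exp.fun_smul (((hμ p hp).cos.fun_smul (hw.hasFDerivAt hp 0)).fun_add
      ((hμ p hp).sin.fun_smul (hw.hasFDerivAt hp 1)))).fderiv]
    simp
    have h1 := hw.structure_one p hp v x
    have h2 := hw.structure_two p hp v x
    linear_combination Real.exp (b p) * (Real.cos (μ p) * h1 + Real.sin (μ p) * h2)

theorem IsNormalForm.contDiffOn (hw : IsCoframe W w) {μ b a : E → ℝ}
    (h : IsNormalForm c W w μ b a) :
    ContDiffOn ℝ ∞ μ W ∧ ContDiffOn ℝ ∞ b W ∧ ContDiffOn ℝ ∞ a W := by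
  have hμ := contDiffOn_of_total_differential hw.isOpen hw.isIntegrable_angle.smooth h.angle
  have hb := contDiffOn_of_total_differential hw.isOpen
    (hw.isIntegrable_height hμ h.angle).smooth h.height
  exact ⟨hμ, hb, contDiffOn_of_total_differential hw.isOpen
    (hw.isIntegrable_width hμ hb h.angle h.height).smooth h.width⟩

theorem IsCoframe.exists_isNormalForm [FiniteDimensional ℝ E] (hw : IsCoframe W w) (hc : c ∈ W)
    (hstar : IsStar c W) : ∃ μ b a : E → ℝ, IsNormalForm c W w μ b a := by
  obtain ⟨μ, hμ0, hμ⟩ := exists_total_differential hw.isOpen hc hstar hw.isIntegrable_angle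
  have hμs := contDiffOn_of_total_differential hw.isOpen hw.isIntegrable_angle.smooth hμ
  obtain ⟨b, hb0, hb⟩ := exists_total_differential hw.isOpen hc hstar
    (hw.isIntegrable_height hμs hμ)
  have hbs := contDiffOn_of_total_differential hw.isOpen (hw.isIntegrable_height hμs hμ).smooth hb
  obtain ⟨a, ha0, ha⟩ := exists_total_differential hw.isOpen hc hstar
    (hw.isIntegrable_width hμs hbs hμ hb)
  exact ⟨μ, b, a, hμ0, hb0, ha0, hμ, hb, ha⟩

/-- The equations are triangular: equality of the angles makes the equations for b agree, and then
those for a agree too. -/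
theorem IsNormalForm.eqOn (hw : IsCoframe W w) (hstar : IsStar c W)
    {μ b a μ' b' a' : E → ℝ} (h : IsNormalForm c W w μ b a) (h' : IsNormalForm c W w μ' b' a') :
    EqOn μ μ' W ∧ EqOn b b' W ∧ EqOn a a' W := by
  obtain ⟨hμs, hbs, -⟩ := h.contDiffOn hw
  have hμ : EqOn μ μ' W := eqOn_of_total_differential hstar hw.isIntegrable_angle h.angle h'.angle
    (h.angle_center.trans h'.angle_center.symm)
  have hb : EqOn b b' W := eqOn_of_total_differential hstar
    (hw.isIntegrable_height hμs h.angle) h.height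
    (fun p hp => by simpa only [hμ hp] using h'.height p hp)
    (h.height_center.trans h'.height_center.symm)
  refine ⟨hμ, hb, eqOn_of_total_differential hstar
    (hw.isIntegrable_width hμs hbs h.angle h.height) h.width
    (fun p hp => by simpa only [hμ hp, hb hp] using h'.width p hp)
    (h.width_center.trans h'.width_center.symm)⟩

theorem IsNormalForm.comp {E' : Type*} [NormedAddCommGroup E'] [NormedSpace ℝ E']
    {W' : Set E'} {w' : Fin 3 → E' → E' →L[ℝ] ℝ} {ι : E →L[ℝ] E'} {μ b a : E' → ℝ}
    (h : IsNormalForm (ι c) W' w' μ b a) (hι : ∀ p ∈ W, ι p ∈ W')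
    (hr : ∀ α, ∀ p ∈ W, (w' α (ι p)).comp ι = w α p) :
    IsNormalForm c W w (fun p => μ (ι p)) (fun p => b (ι p)) (fun p => a (ι p)) where
  angle_center := h.angle_center
  height_center := h.height_center
  width_center := h.width_center
  angle p hp := by
    have := (h.angle _ (hι p hp)).comp p ι.hasFDerivAt
    simpa only [ContinuousLinearMap.sub_comp, ContinuousLinearMap.add_comp,
      ContinuousLinearMap.smul_comp, hr _ p hp] using! this
  height p hp := by
    have := (h.height _ (hι p hp)).comp p ι.hasFDerivAt
    simpa only [ContinuousLinearMap.sub_comp, ContinuousLinearMap.add_comp,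
      ContinuousLinearMap.smul_comp, hr _ p hp] using! this
  width p hp := by
    have := (h.width _ (hι p hp)).comp p ι.hasFDerivAt
    simpa only [ContinuousLinearMap.sub_comp, ContinuousLinearMap.add_comp,
      ContinuousLinearMap.smul_comp, hr _ p hp] using! this

end

/-! ### Straightening -/

/-- The tube lemma; it makes sets defined by conditions along whole segments or discs open. -/
theorem isOpen_setOf_forall_mem_compact {X Y Z : Type*} [TopologicalSpace X] [TopologicalSpace Y]
    [TopologicalSpace Z] {K : Set Y} (hK : IsCompact K) {G : Set Z} (hG : IsOpen G)
    {f : X × Y → Z} (hf : Continuous f) : IsOpen {x | ∀ y ∈ K, f (x, y) ∈ G} := by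
  rw [isOpen_iff_mem_nhds]
  intro x hx
  exact hK.eventually_forall_of_forall_eventually fun y hy =>
    hf.continuousAt.preimage_mem_nhds (hG.mem_nhds (hx y hy))

/-- The set of the points of `W` which `W` joins to `c` by a segment. -/
def starCore {E : Type*} [NormedAddCommGroup E] [NormedSpace ℝ E] (c : E) (W : Set E) : Set E :=
  {p | ∀ s ∈ Icc (0 : ℝ) 1, c + s • (p - c) ∈ W}

section

variable {E : Type*} [NormedAddCommGroup E] [NormedSpace ℝ E] {c : E} {W : Set E}

theorem isOpen_starCore (hW : IsOpen W) : IsOpen (starCore c W) :=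
  isOpen_setOf_forall_mem_compact isCompact_Icc hW
    (f := fun x : E × ℝ => c + x.2 • (x.1 - c)) (by fun_prop)

theorem starCore_subset : starCore c W ⊆ W := fun p hp => by
  simpa using hp 1 (by simp)

theorem isStar_starCore : IsStar c (starCore c W) := by
  intro p hp s hs r hr
  have := hp (r * s) ⟨mul_nonneg hr.1 hs.1, mul_le_one₀ hr.2 hs.1 hs.2⟩
  simpa [smul_smul] using this

theorem center_mem_starCore (hc : c ∈ W) : c ∈ starCore c W := fun s _ => by simpa using hc

end

/-! ### Changing the first two coordinates, and extending a planar diffeomorphism. -/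

/-- The inclusion of the `(x, t)`-plane into `ℝ^{n+2}`. -/
noncomputable def embL (n : ℕ) : Base 0 →L[ℝ] Base n :=
  ContinuousLinearMap.pi fun i => if h : (i : ℕ) < 2 then
    ContinuousLinearMap.proj (R := ℝ) (φ := fun _ => ℝ) (⟨i, h⟩ : Fin 2) else 0

/-- The projection of `ℝ^{n+2}` to the `(x, t)`-plane. -/
noncomputable def headL (n : ℕ) : Base n →L[ℝ] Base 0 :=
  ContinuousLinearMap.pi fun i =>
    ContinuousLinearMap.proj (R := ℝ) (φ := fun _ => ℝ) (Fin.castLE (by omega) i)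

theorem headL_embL (n : ℕ) (z : Base 0) : headL n (embL n z) = z := by
  ext i
  have h : (i : ℕ) ≤ 1 := by omega
  simp [headL, embL, h]

theorem embL_zero (z : Base 0) : embL 0 z = z := by
  ext i
  have h : (i : ℕ) ≤ 1 := by omega
  simp [embL, h]

theorem headL_zero (z : Base 0) : headL 0 z = z := by
  ext i
  simp [headL]

theorem incl_embL (n : ℕ) (z : Base 0) : incl (embL n z) = embL (n + 1) z := by
  ext i
  refine Fin.lastCases ?_ (fun j => ?_) i
  · simp [incl, embL]
  · simp [incl, embL]

theorem headL_incl {n : ℕ} (p : Base n) : headL (n + 1) (incl p) = headL n p := by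
  ext i
  have : (Fin.castLE (by omega) i : Fin (n + 1 + 2)) =
    Fin.castSucc (Fin.castLE (by omega) i : Fin (n + 2)) := rfl
  simp only [headL, ContinuousLinearMap.pi_apply, ContinuousLinearMap.proj_apply, this, incl]
  exact Fin.snoc_castSucc (α := fun _ => ℝ) _ _ _

/-- `ℝ^{n+2}` with the first two coordinates of `p` replaced by `z`. -/
noncomputable def replaceHead {n : ℕ} (p : Base n) (z : Base 0) : Base n :=
  p + embL n (z - headL n p)

theorem headL_replaceHead {n : ℕ} (p : Base n) (z : Base 0) : headL n (replaceHead p z) = z := by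
  simp [replaceHead, headL_embL]

theorem replaceHead_headL {n : ℕ} (p : Base n) : replaceHead p (headL n p) = p := by
  simp [replaceHead]

theorem replaceHead_zero (p z : Base 0) : replaceHead p z = z := by
  simp [replaceHead, embL_zero, headL_zero]

theorem incl_replaceHead {n : ℕ} (p : Base n) (z : Base 0) :
    incl (replaceHead p z) = replaceHead (incl p) z := by
  rw [replaceHead, replaceHead, headL_incl, ← incl_embL, ← inclL_apply, map_add]
  rfl

/-- Replacing the head leaves all τ_i with i ≥ 1 unchanged, so two points with equal images lie in
one (x, t)-slice. Injectivity is thereby a planar question. -/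
theorem eq_replaceHead_of_replaceHead_eq {n : ℕ} {p q : Base n} {y z : Base 0}
    (h : replaceHead p y = replaceHead q z) : q = replaceHead p (headL n q) := by
  have hyz : y = z := by rw [← headL_replaceHead p y, h, headL_replaceHead]
  subst hyz
  simp only [replaceHead, map_sub] at h ⊢
  linear_combination (exp := 1) -h

/-- An injective smooth map with injective derivatives is a diffeomorphism onto its image. -/
theorem exists_openPartialHomeomorph {E : Type*} [NormedAddCommGroup E] [NormedSpace ℝ E]
    [FiniteDimensional ℝ E] {V : Set E} (hV : IsOpen V) {P : E → E} (hP : ContDiffOn ℝ ∞ P V)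
    (hinj : InjOn P V) (hd : ∀ p ∈ V, ∀ x, fderiv ℝ P p x = 0 → x = 0) :
    ∃ e : OpenPartialHomeomorph E E, e.source = V ∧ ⇑e = P ∧
      ContDiffOn ℝ ∞ e.symm e.target := by
  have : CompleteSpace E := FiniteDimensional.complete ℝ E
  have hat : ∀ p ∈ V, ContDiffAt ℝ ∞ P p := fun p hp => hP.contDiffAt (hV.mem_nhds hp)
  have hequiv : ∀ p ∈ V, ∃ L : E ≃L[ℝ] E, (L : E →L[ℝ] E) = fderiv ℝ P p := by
    intro p hp
    refine ⟨(LinearEquiv.ofInjectiveEndo (fderiv ℝ P p : E →ₗ[ℝ] E) ?_).toContinuousLinearEquiv,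
      ?_⟩
    · exact (injective_iff_map_eq_zero _).2 (hd p hp)
    · ext x; rfl
  have hopen : IsOpenMap (V.domRestrict P) := by
    rw [isOpenMap_iff_nhds_le]
    rintro ⟨p, hp⟩
    obtain ⟨L, hL⟩ := hequiv p hp
    have hs : HasStrictFDerivAt P (L : E →L[ℝ] E) p := by
      rw [hL]; exact (hat p hp).hasStrictFDerivAt (by simp)
    have h1 := hs.map_nhds_eq_of_equiv
    have h2 : map (V.domRestrict P) (𝓝 ⟨p, hp⟩) = 𝓝 (P p) := by
      rw [← h1, ← map_nhds_subtype_coe_eq_nhds hp (hV.mem_nhds hp), Filter.map_map]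
      rfl
    exact h2.ge
  let e : OpenPartialHomeomorph E E := OpenPartialHomeomorph.ofContinuousOpenRestrict
    (hinj.toPartialEquiv P V) hP.continuousOn hopen hV
  refine ⟨e, rfl, rfl, fun y hy => ?_⟩
  have hp : e.symm y ∈ V := e.map_target hy
  obtain ⟨L, hL⟩ := hequiv _ hp
  refine (e.contDiffAt_symm hy (f₀' := L) ?_ (hat _ hp)).contDiffWithinAt
  rw [hL]
  exact ((hat _ hp).differentiableAt (by simp)).hasFDerivAt

/-- φ − id is ½-Lipschitz, so φ y = φ z forces ‖z − y‖ ≤ ½ ‖z − y‖. -/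
theorem injOn_of_norm_fderiv_sub_id_le {E : Type*} [NormedAddCommGroup E] [NormedSpace ℝ E]
    {s : Set E} (hs : Convex ℝ s) {φ : E → E} {φ' : E → E →L[ℝ] E}
    (hφ : ∀ z ∈ s, HasFDerivAt φ (φ' z) z)
    (hb : ∀ z ∈ s, ‖φ' z - ContinuousLinearMap.id ℝ E‖ ≤ 1 / 2) : InjOn φ s := by
  intro y hy z hz hyz
  have h := hs.norm_image_sub_le_of_norm_hasFDerivWithin_le'
    (fun x hx => (hφ x hx).hasFDerivWithinAt) hb hy hz
  rw [hyz, sub_self, zero_sub, norm_neg] at h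
  have h' : ‖z - y‖ ≤ 1 / 2 * ‖z - y‖ := h
  have h0 : ‖z - y‖ = 0 := by linarith [norm_nonneg (z - y)]
  exact (sub_eq_zero.1 (norm_eq_zero.1 h0)).symm

theorem hasFDerivAt_replaceHead {n : ℕ} {f : Base n → Base 0} {f' : Base n →L[ℝ] Base 0}
    {p : Base n} (hf : HasFDerivAt f f' p) : HasFDerivAt (fun q => replaceHead q (f q))
      (ContinuousLinearMap.id ℝ (Base n) + (embL n).comp (f' - headL n)) p :=
  (hasFDerivAt_id p).add ((embL n).hasFDerivAt.comp p (hf.sub (headL n).hasFDerivAt))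

/-- Compatible maps `f n` to the plane, the first of which is a local diffeomorphism at `c`, are the
first two components of compatible local diffeomorphisms. -/
theorem exists_straightening {W : (n : ℕ) → Set (Base n)} (hW : ∀ n, IsOpen (W n))
    (hincl : ∀ n, ∀ p ∈ W n, incl p ∈ W (n + 1)) {f : (n : ℕ) → Base n → Base 0}
    (hf : ∀ n, ContDiffOn ℝ ∞ (f n) (W n)) (hfincl : ∀ n, ∀ p ∈ W n, f (n + 1) (incl p) = f n p)
    {c : Base 0} (hc : c ∈ W 0) (hd : ∀ x, fderiv ℝ (f 0) c x = 0 → x = 0) :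
    ∃ e : (n : ℕ) → OpenPartialHomeomorph (Base n) (Base n), c ∈ (e 0).source ∧
      (∀ n, (e n).source ⊆ W n ∧ ContDiffOn ℝ ∞ (e n) (e n).source ∧
        ContDiffOn ℝ ∞ (e n).symm (e n).target ∧ ∀ p, e n p = replaceHead p (f n p)) ∧
      ∀ n, ∀ p ∈ (e n).source, incl p ∈ (e (n + 1)).source ∧
        e (n + 1) (incl p) = incl (e n p) := by
  have hfd : ∀ n, ∀ p ∈ W n, HasFDerivAt (f n) (fderiv ℝ (f n) p) p := fun n p hp =>
    (((hf n).contDiffAt ((hW n).mem_nhds hp)).differentiableAt (by simp)).hasFDerivAt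
  obtain ⟨L, hL⟩ : ∃ L : Base 0 ≃L[ℝ] Base 0, (L : Base 0 →L[ℝ] Base 0) = fderiv ℝ (f 0) c :=
    ⟨(LinearEquiv.ofInjectiveEndo (fderiv ℝ (f 0) c : Base 0 →ₗ[ℝ] Base 0)
      ((injective_iff_map_eq_zero _).2 hd)).toContinuousLinearEquiv, by ext x; rfl⟩
  set T : Base 0 →L[ℝ] Base 0 := L.symm.toContinuousLinearMap with hT
  -- The (x, t)-derivative of f, normalized by its inverse at c, minus the identity. It involves
  -- only slice directions, so it takes the same value at p and at `incl p`.
  set N : (n : ℕ) → Base n → Base 0 →L[ℝ] Base 0 := fun n p =>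
    (T.comp (fderiv ℝ (f n) p)).comp (embL n) - ContinuousLinearMap.id ℝ (Base 0) with hN
  set G : (n : ℕ) → Set (Base n) := fun n => {p ∈ W n | ‖N n p‖ < 1 / 2}
  have hGopen : ∀ n, IsOpen (G n) := by
    intro n
    have h1 : ContinuousOn (fderiv ℝ (f n)) (W n) :=
      (hf n).continuousOn_fderiv_of_isOpen (hW n) (by simp)
    have h2 : ContinuousOn (fun p => ‖N n p‖) (W n) :=
      ((((continuousOn_const (c := T)).clm_comp h1).clm_comp continuousOn_const).sub
        continuousOn_const).norm
    exact h2.isOpen_inter_preimage (hW n) (isOpen_Iio (a := 1 / 2))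
  have hGincl : ∀ n, ∀ p ∈ G n, incl p ∈ G (n + 1) := by
    intro n p hp
    refine ⟨hincl n p hp.1, ?_⟩
    have h1 : HasFDerivAt (f n) ((fderiv ℝ (f (n + 1)) (incl p)).comp (inclL n)) p := by
      refine ((hfd (n + 1) _ (hincl n p hp.1)).comp p (inclL n).hasFDerivAt).congr_of_eventuallyEq
        ?_
      filter_upwards [(hW n).mem_nhds hp.1] with q hq using (hfincl n q hq).symm
    have h2 : N (n + 1) (incl p) = N n p := by
      ext1 z
      simp [hN, h1.fderiv, incl_embL]
    rw [h2]
    exact hp.2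
  have hGc : c ∈ G 0 := by
    refine ⟨hc, ?_⟩
    have : N 0 c = 0 := by
      ext1 z
      simp [hN, ← hL, hT, embL_zero]
    rw [this, norm_zero]
    norm_num
  obtain ⟨r, hr, hrG⟩ := nhds_basis_closedBall.mem_iff.1 ((hGopen 0).mem_nhds hGc)
  -- The radius r comes from level 0 and serves all n. No size in the τ-directions is prescribed: a
  -- point belongs to V n when its whole slice over the closed disc lies in G n, and this is
  -- inherited under `incl`. The slice is convex, as injectivity requires.
  set V : (n : ℕ) → Set (Base n) := fun n =>
    {p | headL n p ∈ ball c r ∧ ∀ z ∈ closedBall c r, replaceHead p z ∈ G n}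
  have hVG : ∀ n, V n ⊆ G n := by
    intro n p hp
    have := hp.2 _ (ball_subset_closedBall hp.1)
    rwa [replaceHead_headL] at this
  have hVW : ∀ n, V n ⊆ W n := fun n p hp => (hVG n hp).1
  have hVopen : ∀ n, IsOpen (V n) := by
    intro n
    refine (isOpen_ball.preimage (headL n).continuous).inter
      (isOpen_setOf_forall_mem_compact (isCompact_closedBall c r) (hGopen n)
        (f := fun x : Base n × Base 0 => replaceHead x.1 x.2) ?_)
    unfold replaceHead
    fun_prop
  have hker : ∀ n, ∀ p ∈ G n, ∀ z, fderiv ℝ (f n) p (embL n z) = 0 → z = 0 := by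
    intro n p hp z hz
    have h1 : N n p z = -z := by simp [hN, hz]
    have h2 := (N n p).le_opNorm z
    rw [h1, norm_neg] at h2
    have h3 := mul_le_mul_of_nonneg_right hp.2.le (norm_nonneg z)
    exact norm_eq_zero.1 (by linarith [norm_nonneg z])
  have hex : ∀ n, ∃ e : OpenPartialHomeomorph (Base n) (Base n), e.source = V n ∧
      (⇑e = fun p => replaceHead p (f n p)) ∧ ContDiffOn ℝ ∞ e.symm e.target := by
    intro n
    refine exists_openPartialHomeomorph (hVopen n) ?_ ?_ ?_
    · unfold replaceHead
      exact contDiffOn_id.add ((embL n).contDiff.comp_contDiffOn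
        (((hf n).mono (hVW n)).sub (headL n).contDiff.contDiffOn))
    · intro p hp q hq hpq
      replace hpq : replaceHead p (f n p) = replaceHead q (f n q) := hpq
      have hq' := eq_replaceHead_of_replaceHead_eq hpq
      have hfpq : f n p = f n q := by
        rw [← headL_replaceHead p (f n p), hpq, headL_replaceHead]
      have hslice : ∀ z, HasFDerivAt (fun z => replaceHead p z) (embL n) z := fun z =>
        ((embL n).hasFDerivAt.comp z ((hasFDerivAt_id z).sub_const _)).const_add p
      have hinj := injOn_of_norm_fderiv_sub_id_le (convex_closedBall c r)
        (φ := fun z => T (f n (replaceHead p z)))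
        (φ' := fun z => (T.comp (fderiv ℝ (f n) (replaceHead p z))).comp (embL n))
        (fun z hz => T.hasFDerivAt.comp z ((hfd n _ (hp.2 z hz).1).comp z (hslice z)))
        (fun z hz => (hp.2 z hz).2.le)
      have := hinj (ball_subset_closedBall hp.1) (ball_subset_closedBall hq.1)
        (by simp only [← hq', replaceHead_headL, hfpq])
      rw [hq', ← this, replaceHead_headL]
    · intro p hp x hx
      rw [(hasFDerivAt_replaceHead (hfd n p (hVW n hp))).fderiv] at hx
      have hx' : x + embL n (fderiv ℝ (f n) p x - headL n x) = 0 := by simpa using hx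
      have h1 : fderiv ℝ (f n) p x = 0 := by
        have := congrArg (headL n) hx'
        simpa [headL_embL] using this
      have h2 : x = embL n (headL n x) := by
        rw [h1, zero_sub, map_neg] at hx'
        exact add_neg_eq_zero.1 hx'
      have h3 := hker n p (hVG n hp) (headL n x) (by rw [← h2, h1])
      rw [h2, h3, map_zero]
  choose e he1 he2 he3 using hex
  refine ⟨e, ?_, fun n => ⟨(he1 n).symm ▸ hVW n, ?_, he3 n, fun p => by rw [he2]⟩, fun n p hp => ?_⟩
  · rw [he1]
    refine ⟨by rw [headL_zero]; exact mem_ball_self hr, fun z hz => ?_⟩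
    rw [replaceHead_zero]
    exact hrG hz
  · rw [he1, he2]
    unfold replaceHead
    exact contDiffOn_id.add ((embL n).contDiff.comp_contDiffOn
      (((hf n).mono (hVW n)).sub (headL n).contDiff.contDiffOn))
  · rw [he1] at hp
    refine ⟨?_, ?_⟩
    · rw [he1]
      refine ⟨by rw [headL_incl]; exact hp.1, fun z hz => ?_⟩
      rw [← incl_replaceHead]
      exact hGincl n _ (hp.2 z hz)
    · simp only [he2]
      rw [incl_replaceHead, hfincl n p (hVW n hp)]

/-! ### Normalization and comparison -/

/-- Compatible local diffeomorphisms `e n` and angles `μ n` which transform the coframe `w n` to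
the coframe `exp (-b) da`, `db`, where `a`, `b` are the first two coordinates. -/
structure IsNormalization (dom : (n : ℕ) → Set (Base n))
    (w : (n : ℕ) → Fin 3 → Base n → Base n →L[ℝ] ℝ)
    (e : (n : ℕ) → OpenPartialHomeomorph (Base n) (Base n)) (μ : (n : ℕ) → Base n → ℝ) :
    Prop where
  source_subset : ∀ n, (e n).source ⊆ dom n
  zero_mem_target : (0 : Base 0) ∈ (e 0).target
  smooth : ∀ n, ContDiffOn ℝ ∞ (e n) (e n).source
  smooth_symm : ∀ n, ContDiffOn ℝ ∞ (e n).symm (e n).target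
  smooth_angle : ∀ n, ContDiffOn ℝ ∞ (μ n) (e n).source
  form_one : ∀ n, ∀ p ∈ (e n).source, ∀ v,
    Real.cos (μ n p) * w n 0 p v + Real.sin (μ n p) * w n 1 p v =
      Real.exp (-headL n (e n p) 1) * headL n (fderiv ℝ (e n) p v) 0
  form_two : ∀ n, ∀ p ∈ (e n).source, ∀ v,
    -Real.sin (μ n p) * w n 0 p v + Real.cos (μ n p) * w n 1 p v = headL n (fderiv ℝ (e n) p v) 1
  form_three : ∀ n, ∀ p ∈ (e n).source, ∀ v,
    w n 2 p v + fderiv ℝ (μ n) p v =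
      Real.exp (-headL n (e n p) 1) * headL n (fderiv ℝ (e n) p v) 0
  source_incl : ∀ n, ∀ p ∈ (e n).source, incl p ∈ (e (n + 1)).source
  map_incl : ∀ n, ∀ p ∈ (e n).source, e (n + 1) (incl p) = incl (e n p)
  angle_incl : ∀ n, ∀ p ∈ (e n).source, μ (n + 1) (incl p) = μ n p

theorem incl_mem_starCore {dom : (n : ℕ) → Set (Base n)}
    (h : ∀ n, ∀ p ∈ dom n, incl p ∈ dom (n + 1)) (c : Base 0) (n : ℕ) :
    ∀ p ∈ starCore (embL n c) (dom n), incl p ∈ starCore (embL (n + 1) c) (dom (n + 1)) := by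
  intro p hp s hs
  have := h n _ (hp s hs)
  rwa [← inclL_apply, map_add, map_smul, map_sub, inclL_apply, inclL_apply, incl_embL] at this

theorem embL_mem {dom : (n : ℕ) → Set (Base n)} (h : ∀ n, ∀ p ∈ dom n, incl p ∈ dom (n + 1))
    {c : Base 0} (hc : c ∈ dom 0) (n : ℕ) : embL n c ∈ dom n := by
  induction n with
  | zero => rwa [embL_zero]
  | succ n ih => rw [← incl_embL]; exact h n _ ih

/-- The normal form is centred at one point c of the plane at every level, and the pair (a, b) is
straightened. Rotating and rescaling by exp b do not affect nondegeneracy, so (a, b) is a local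
diffeomorphism of the plane at c. -/
theorem IsCoframeSequence.exists_isNormalization {dom : (n : ℕ) → Set (Base n)}
    {w : (n : ℕ) → Fin 3 → Base n → Base n →L[ℝ] ℝ} (hw : IsCoframeSequence dom w) :
    ∃ e μ, IsNormalization dom w e μ := by
  obtain ⟨c, hc⟩ := hw.nonempty_dom
  set W : (n : ℕ) → Set (Base n) := fun n => starCore (embL n c) (dom n)
  have hWdom : ∀ n, W n ⊆ dom n := fun n => starCore_subset
  have hWopen : ∀ n, IsOpen (W n) := fun n => isOpen_starCore (hw.coframe n).isOpen
  have hcW : ∀ n, embL n c ∈ W n := fun n => center_mem_starCore (embL_mem hw.dom_incl hc n)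
  have hcof : ∀ n, IsCoframe (W n) (w n) := fun n => (hw.coframe n).mono (hWopen n) (hWdom n)
  have hWincl : ∀ n, ∀ p ∈ W n, incl p ∈ W (n + 1) := incl_mem_starCore hw.dom_incl c
  have hex : ∀ n, ∃ μ b a : Base n → ℝ, IsNormalForm (embL n c) (W n) (w n) μ b a := fun n =>
    (hcof n).exists_isNormalForm (hcW n) isStar_starCore
  choose μ b a hnf using hex
  have hincl : ∀ n, EqOn (μ n) (fun p => μ (n + 1) (incl p)) (W n) ∧
      EqOn (b n) (fun p => b (n + 1) (incl p)) (W n) ∧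
      EqOn (a n) (fun p => a (n + 1) (incl p)) (W n) := by
    intro n
    have h1 := hnf (n + 1)
    rw [← incl_embL, ← inclL_apply] at h1
    -- The restriction of the normal form of level n + 1 is a normal form of level n with the same
    -- centre, so uniqueness applies.
    exact (hnf n).eqOn (hcof n) isStar_starCore
      (h1.comp (hWincl n) fun α p hp => hw.restrict n α p (hWdom n hp))
  have hf : ∀ n, ContDiffOn ℝ ∞ (fun p => (![a n p, b n p] : Base 0)) (W n) := by
    intro n
    obtain ⟨-, hb, ha⟩ := (hnf n).contDiffOn (hcof n)
    refine contDiffOn_pi.2 fun i => ?_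
    fin_cases i
    · exact ha
    · exact hb
  have hfd : ∀ n, ∀ p ∈ W n, ∀ v, fderiv ℝ (fun p => (![a n p, b n p] : Base 0)) p v =
      ![Real.exp (b n p) * (Real.cos (μ n p) * w n 0 p v + Real.sin (μ n p) * w n 1 p v),
        -Real.sin (μ n p) * w n 0 p v + Real.cos (μ n p) * w n 1 p v] := by
    intro n p hp v
    have h : HasFDerivAt (fun p => (![a n p, b n p] : Base 0)) (ContinuousLinearMap.pi
        ![Real.exp (b n p) • (Real.cos (μ n p) • w n 0 p + Real.sin (μ n p) • w n 1 p),
          -Real.sin (μ n p) • w n 0 p + Real.cos (μ n p) • w n 1 p]) p := by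
      refine hasFDerivAt_pi.2 fun i => ?_
      fin_cases i
      · exact (hnf n).width p hp
      · exact (hnf n).height p hp
    rw [h.fderiv]
    ext i
    fin_cases i <;> simp [mul_add]
  have hc0 : c ∈ W 0 := by simpa only [embL_zero] using hcW 0
  obtain ⟨e, hce, he, hei⟩ := exists_straightening hWopen hWincl hf
    (fun n p hp => by
      have h1 := (hincl n).2.1 hp
      have h2 := (hincl n).2.2 hp
      simp only at h1 h2
      rw [h1, h2]) hc0
    (fun x hx => by
      rw [hfd 0 c hc0] at hx
      have h0 : Real.exp (b 0 c) * (Real.cos (μ 0 c) * w 0 0 c x + Real.sin (μ 0 c) * w 0 1 c x) =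
        0 := congrFun hx 0
      have h1 : -Real.sin (μ 0 c) * w 0 0 c x + Real.cos (μ 0 c) * w 0 1 c x = 0 := congrFun hx 1
      replace h0 := (mul_eq_zero.1 h0).resolve_left (Real.exp_ne_zero _)
      have h2 := Real.sin_sq_add_cos_sq (μ 0 c)
      refine hw.nondegenerate c hc x ?_ ?_
      · linear_combination Real.cos (μ 0 c) * h0 - Real.sin (μ 0 c) * h1 - w 0 0 c x * h2
      · linear_combination Real.sin (μ 0 c) * h0 + Real.cos (μ 0 c) * h1 - w 0 1 c x * h2)
  have hhead : ∀ n p, headL n (e n p) = ![a n p, b n p] := fun n p => by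
    rw [(he n).2.2.2, headL_replaceHead]
  have hsrc : ∀ n, (e n).source ⊆ W n := fun n => (he n).1
  have hed : ∀ n, ∀ p ∈ (e n).source, ∀ v, headL n (fderiv ℝ (e n) p v) =
      fderiv ℝ (fun p => (![a n p, b n p] : Base 0)) p v := by
    intro n p hp v
    have h1 : HasFDerivAt (e n) (fderiv ℝ (e n) p) p :=
      (((he n).2.1.contDiffAt ((e n).open_source.mem_nhds hp)).differentiableAt
        (by simp)).hasFDerivAt
    have h2 := (headL n).hasFDerivAt.comp p h1
    have h3 : (headL n) ∘ (e n) = fun p => (![a n p, b n p] : Base 0) := funext (hhead n)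
    rw [h3] at h2
    rw [h2.fderiv]
    rfl
  refine ⟨e, μ, fun n => (hsrc n).trans (hWdom n), ?_, fun n => (he n).2.1, fun n => (he n).2.2.1,
    fun n => ((hnf n).contDiffOn (hcof n)).1.mono (hsrc n), ?_, ?_, ?_, fun n p hp => (hei n p hp).1,
    fun n p hp => (hei n p hp).2, fun n p hp => ((hincl n).1 (hsrc n hp)).symm⟩
  -- Since a and b vanish at c, `e 0` sends c to the origin. This point is common to the targets of
  -- any two normalizations, so their composition has non-empty domain.
  · have h := (e 0).map_source hce
    have ha := (hnf 0).width_center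
    have hb := (hnf 0).height_center
    rw [embL_zero] at ha hb
    rwa [← headL_zero (e 0 c), hhead, ha, hb,
      show (![0, 0] : Base 0) = 0 from by ext i; fin_cases i <;> rfl] at h
  · intro n p hp v
    rw [hed n p hp, hhead, hfd n p (hsrc n hp)]
    simp [← mul_assoc, ← Real.exp_add]
  · intro n p hp v
    rw [hed n p hp, hfd n p (hsrc n hp)]
    simp
  · intro n p hp v
    rw [hed n p hp, hhead, hfd n p (hsrc n hp), ((hnf n).angle p (hsrc n hp)).fderiv]
    simp [← mul_assoc, ← Real.exp_add]

theorem mem_source_trans_symm_iff {E : Type*} [TopologicalSpace E]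
    (e e' : OpenPartialHomeomorph E E) (p : E) :
    p ∈ (e.trans e'.symm).source ↔ p ∈ e.source ∧ e p ∈ e'.target := by
  simp

theorem IsNormalization.incl_mem_target {dom : (n : ℕ) → Set (Base n)}
    {w : (n : ℕ) → Fin 3 → Base n → Base n →L[ℝ] ℝ}
    {e : (n : ℕ) → OpenPartialHomeomorph (Base n) (Base n)} {μ : (n : ℕ) → Base n → ℝ}
    (h : IsNormalization dom w e μ) {n : ℕ} {y : Base n} (hy : y ∈ (e n).target) :
    incl y ∈ (e (n + 1)).target ∧ (e (n + 1)).symm (incl y) = incl ((e n).symm y) := by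
  have hp := (e n).map_target hy
  have h1 := h.map_incl n _ hp
  rw [(e n).right_inv hy] at h1
  have h2 := h.source_incl n _ hp
  refine ⟨h1 ▸ (e (n + 1)).map_source h2, ?_⟩
  rw [← h1, (e (n + 1)).left_inv h2]

end PSHierarchy

/-! ### Comparison of two solutions through the common normal form. -/

theorem mainTheorem1
    (D D' : Set PSHierarchy.Jet) (F F' : ℕ → PSHierarchy.Jet → ℝ)
    (θ θ' : Fin 3 → ℕ → PSHierarchy.Jet → ℝ)
    (hF : PSHierarchy.IsHierarchy D F θ) (hF' : PSHierarchy.IsHierarchy D' F' θ')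
    (dom dom' : (n : ℕ) → Set (PSHierarchy.Base n))
    (u u' : (n : ℕ) → PSHierarchy.Base n → ℝ)
    (hu : PSHierarchy.IsSolution D F dom u) (hu' : PSHierarchy.IsSolution D' F' dom' u')
    (hgen : PSHierarchy.IsIIIGeneric θ (dom 0) (u 0))
    (hgen' : PSHierarchy.IsIIIGeneric θ' (dom' 0) (u' 0)) :
    ∃ (Υ : (n : ℕ) → OpenPartialHomeomorph (PSHierarchy.Base n) (PSHierarchy.Base n))
      (μ : (n : ℕ) → PSHierarchy.Base n → ℝ),
      (∀ n : ℕ,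
        (Υ n).source.Nonempty ∧ (Υ n).source ⊆ dom n ∧ (Υ n).target ⊆ dom' n ∧
        ContDiffOn ℝ ∞ (Υ n) (Υ n).source ∧ ContDiffOn ℝ ∞ (Υ n).symm (Υ n).target ∧
        ContDiffOn ℝ ∞ (μ n) (Υ n).source ∧
        ∀ p ∈ (Υ n).source,
          (PSHierarchy.pullForm θ' (u' n) 0 (Υ n p)).comp (fderiv ℝ (Υ n) p) =
            Real.cos (μ n p) • PSHierarchy.pullForm θ (u n) 0 p +
              Real.sin (μ n p) • PSHierarchy.pullForm θ (u n) 1 p ∧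
          (PSHierarchy.pullForm θ' (u' n) 1 (Υ n p)).comp (fderiv ℝ (Υ n) p) =
            -(Real.sin (μ n p) • PSHierarchy.pullForm θ (u n) 0 p) +
              Real.cos (μ n p) • PSHierarchy.pullForm θ (u n) 1 p ∧
          (PSHierarchy.pullForm θ' (u' n) 2 (Υ n p)).comp (fderiv ℝ (Υ n) p) =
            PSHierarchy.pullForm θ (u n) 2 p + fderiv ℝ (μ n) p) ∧
      (∀ n : ℕ, ∀ p ∈ (Υ n).source,
        PSHierarchy.incl p ∈ (Υ (n + 1)).source ∧
        Υ (n + 1) (PSHierarchy.incl p) = PSHierarchy.incl (Υ n p) ∧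
        μ (n + 1) (PSHierarchy.incl p) = μ n p) := by
  obtain ⟨e, m, h⟩ := (PSHierarchy.isCoframeSequence_pullForm hF hu hgen).exists_isNormalization
  obtain ⟨e', m', h'⟩ :=
    (PSHierarchy.isCoframeSequence_pullForm hF' hu' hgen').exists_isNormalization
  have hsrc : ∀ n p, p ∈ ((e n).trans (e' n).symm).source →
      p ∈ (e n).source ∧ e n p ∈ (e' n).target := fun n p =>
    (PSHierarchy.mem_source_trans_symm_iff (e n) (e' n) p).1
  have htgt : ∀ n p, p ∈ ((e n).trans (e' n).symm).target →
      p ∈ (e' n).source ∧ e' n p ∈ (e n).target := by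
    intro n p hp
    rw [← OpenPartialHomeomorph.symm_source, OpenPartialHomeomorph.trans_symm_eq_symm_trans_symm]
      at hp
    exact (PSHierarchy.mem_source_trans_symm_iff (e' n) (e n) p).1 hp
  have hnest : ∀ n, ∀ p ∈ ((e n).trans (e' n).symm).source,
      PSHierarchy.incl p ∈ ((e (n + 1)).trans (e' (n + 1)).symm).source ∧
      (e (n + 1)).trans (e' (n + 1)).symm (PSHierarchy.incl p) =
        PSHierarchy.incl ((e n).trans (e' n).symm p) := by
    intro n p hp
    obtain ⟨hp1, hp2⟩ := hsrc n p hp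
    have h1 := h.map_incl n p hp1
    have h2 := h'.incl_mem_target hp2
    refine ⟨(PSHierarchy.mem_source_trans_symm_iff _ _ _).2 ⟨h.source_incl n p hp1, ?_⟩, ?_⟩
    · rw [h1]; exact h2.1
    · simp only [OpenPartialHomeomorph.coe_trans, Function.comp_apply, h1, h2.2]
  have hsm : ∀ n, ContDiffOn ℝ ∞ ((e n).trans (e' n).symm) ((e n).trans (e' n).symm).source :=
    fun n => (h'.smooth_symm n).comp ((h.smooth n).mono fun p hp => (hsrc n p hp).1)
      fun p hp => (hsrc n p hp).2
  have hmsm : ∀ n, ContDiffOn ℝ ∞ (fun p => m' n ((e n).trans (e' n).symm p))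
      ((e n).trans (e' n).symm).source := fun n =>
    (h'.smooth_angle n).comp (hsm n) fun p hp => (e' n).map_target (hsrc n p hp).2
  -- Rotation by m leads from the first coframe to the normal form, and rotation by −m' from there
  -- to the second; hence the difference of the angles.
  refine ⟨fun n => (e n).trans (e' n).symm, fun n p => m n p - m' n ((e n).trans (e' n).symm p),
    fun n => ⟨?_, fun p hp => h.source_subset n (hsrc n p hp).1,
      fun p hp => h'.source_subset n (htgt n p hp).1, hsm n, ?_,
      ((h.smooth_angle n).mono fun p hp => (hsrc n p hp).1).sub (hmsm n), ?_⟩,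
    fun n p hp => ⟨(hnest n p hp).1, (hnest n p hp).2, ?_⟩⟩
  -- At level 0 the preimage of the origin lies in the domain; `incl` carries it to every higher
  -- level.
  · induction n with
    | zero =>
      refine ⟨(e 0).symm 0, (PSHierarchy.mem_source_trans_symm_iff _ _ _).2
        ⟨(e 0).map_target h.zero_mem_target, ?_⟩⟩
      rw [(e 0).right_inv h.zero_mem_target]
      exact h'.zero_mem_target
    | succ n ih =>
      obtain ⟨p, hp⟩ := ih
      exact ⟨_, (hnest n p hp).1⟩
  · exact (h.smooth_symm n).comp ((h'.smooth n).mono fun p hp => (htgt n p hp).1)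
      fun p hp => (htgt n p hp).2
  · intro p hp
    obtain ⟨hp1, hp2⟩ := hsrc n p hp
    set Υ := (e n).trans (e' n).symm with hΥ
    have hΥs : Υ p ∈ (e' n).source := (e' n).map_target hp2
    have hnhds := Υ.open_source.mem_nhds hp
    have heΥ : e' n (Υ p) = e n p := (e' n).right_inv hp2
    have hΥd : HasFDerivAt Υ (fderiv ℝ Υ p) p :=
      (((hsm n).contDiffAt hnhds).differentiableAt (by simp)).hasFDerivAt
    have hed : ∀ v, fderiv ℝ (e' n) (Υ p) (fderiv ℝ Υ p v) = fderiv ℝ (e n) p v := by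
      intro v
      have h1 : HasFDerivAt (e' n) (fderiv ℝ (e' n) (Υ p)) (Υ p) :=
        (((h'.smooth n).contDiffAt ((e' n).open_source.mem_nhds hΥs)).differentiableAt
          (by simp)).hasFDerivAt
      have h2 := h1.comp p hΥd
      have h3 : (e n : PSHierarchy.Base n → PSHierarchy.Base n) =ᶠ[nhds p] e' n ∘ Υ := by
        filter_upwards [hnhds] with q hq
        exact ((e' n).right_inv (hsrc n q hq).2).symm
      rw [h3.fderiv_eq, h2.fderiv]
      rfl
    have hmd : ∀ v, fderiv ℝ (fun p => m n p - m' n (Υ p)) p v =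
        fderiv ℝ (m n) p v - fderiv ℝ (m' n) (Υ p) (fderiv ℝ Υ p v) := by
      intro v
      have h1 : HasFDerivAt (m' n) (fderiv ℝ (m' n) (Υ p)) (Υ p) :=
        (((h'.smooth_angle n).contDiffAt ((e' n).open_source.mem_nhds hΥs)).differentiableAt
          (by simp)).hasFDerivAt
      have h2 : HasFDerivAt (m n) (fderiv ℝ (m n) p) p :=
        (((h.smooth_angle n).contDiffAt ((e n).open_source.mem_nhds hp1)).differentiableAt
          (by simp)).hasFDerivAt
      have h3 : HasFDerivAt (fun p => m n p - m' n (Υ p))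
          (fderiv ℝ (m n) p - (fderiv ℝ (m' n) (Υ p)).comp (fderiv ℝ Υ p)) p :=
        h2.sub (h1.comp p hΥd)
      rw [h3.fderiv]
      rfl
    have hs := Real.sin_sq_add_cos_sq (m' n (Υ p))
    have h1 := fun v => h.form_one n p hp1 v
    have h2 := fun v => h.form_two n p hp1 v
    have h3 := fun v => h.form_three n p hp1 v
    have h1' := fun v => h'.form_one n (Υ p) hΥs (fderiv ℝ Υ p v)
    have h2' := fun v => h'.form_two n (Υ p) hΥs (fderiv ℝ Υ p v)
    have h3' := fun v => h'.form_three n (Υ p) hΥs (fderiv ℝ Υ p v)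
    simp only [hed, heΥ] at h1' h2' h3'
    -- Both coframes have the same normalized expressions in terms of e. The first two identities
    -- undo the rotation by m'; in the third the angles enter additively.
    refine ⟨?_, ?_, ?_⟩
    · ext v
      simp only [Real.cos_sub, Real.sin_sub, ContinuousLinearMap.comp_apply, add_apply, smul_apply,
        smul_eq_mul]
      linear_combination Real.cos (m' n (Υ p)) * (h1' v - h1 v) -
        Real.sin (m' n (Υ p)) * (h2' v - h2 v) -
        PSHierarchy.pullForm θ' (u' n) 0 (Υ p) (fderiv ℝ Υ p v) * hs
    · ext v
      simp only [Real.cos_sub, Real.sin_sub, ContinuousLinearMap.comp_apply, add_apply, smul_apply,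
        neg_apply, smul_eq_mul]
      linear_combination Real.sin (m' n (Υ p)) * (h1' v - h1 v) +
        Real.cos (m' n (Υ p)) * (h2' v - h2 v) -
        PSHierarchy.pullForm θ' (u' n) 1 (Υ p) (fderiv ℝ Υ p v) * hs
    · ext v
      change _ = PSHierarchy.pullForm θ (u n) 2 p v + fderiv ℝ (fun p => m n p - m' n (Υ p)) p v
      rw [hmd, ContinuousLinearMap.comp_apply]
      linear_combination h3' v - h3 v
  · have hm := h.angle_incl n p (hsrc n p hp).1
    have hm' := h'.angle_incl n _ ((e' n).map_target (hsrc n p hp).2)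
    have hn := (hnest n p hp).2
    simp only
    rw [hn, hm]
    exact congrArg _ hm'
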